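/- All graphs are finite, undirected and simple. Let $G$ be a graph. For a matching $M$ of $G$, an $M$-blossom is an odd cycle $C$ of $G$ of length $2k+1$ exactly $k$ of whose edges lie in $M$; its base is the unique vertex of $C$ not covered by these $k$ edges. An $M$-stem is an $M$-alternating path of even length (possibly zero) joining the base to a vertex not saturated by $M$. (A path is $M$-alternating if exactly one of any two consecutive edges belongs to $M$.) An $M$-flower $F$ is an $M$-blossom together with an $M$-stem whose only common vertex with the blossom is the base; $V(F)$ is the set of vertices of the blossom and the stem. For an odd cycle $C$ of $G$, the reach set of $C$ is $$R(C)=\bigcup_F V(F),$$ where the union is over all $M$-flowers $F$ of $G$ having $C$ as their $M$-blossom, for some maximum matching $M$ of $G$. The graph $G$ is $R$-disjoint if it has at least one odd cycle, $R(C)\neq\emptyset$ for every odd cycle $C$ of $G$, and $R(C)\cap R(C')=\emptyset$ for every pair of distinct odd cycles $C,C'$ of $G$. For $X\subseteq V(G)$ put $d_G(X)=|X|-|N(X)|$, where $N(X)$ is the set of vertices having a neighbor in $X$. An independent set $S$ is critical if $d_G(S)=\max\{d_G(X): X \text{ an independent set of } G\}$. Let $\ker(G)$ be the intersection of all critical independent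 sets of $G$, and let $\mathrm{core}(G)$ be the intersection of all independent sets of $G$ of maximum cardinality. **Theorem.** If $G$ is an $R$-disjoint graph, then $\ker(G)=\mathrm{core}(G)$. -/

import Mathlib

namespace RDisjoint

variable {V : Type*}

/-! ### Matchings -/

/-- `M` is a maximum matching of `G`: a matching with the largest possible number of edges. -/
def IsMaximumMatching (G : SimpleGraph V) (M : G.Subgraph) : Prop :=
  M.IsMatching ∧
    ∀ M' : G.Subgraph, M'.IsMatching → M'.edgeSet.ncard ≤ M.edgeSet.ncard

/-- A walk is `M`-alternating if, of any two consecutive edges, exactly one belongs to `M`. -/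
def IsAlternatingWalk {G : SimpleGraph V} (M : G.Subgraph) {u v : V} (p : G.Walk u v) : Prop :=
  p.edges.IsChain (fun e f => Xor (e ∈ M.edgeSet) (f ∈ M.edgeSet))

/-! ### Odd cycles, blossoms and flowers -/

/-- `C` is an odd cycle of `G`. Cycles are subgraphs of `G`, so that two closed walks that
differ only in their starting point or direction give the same cycle. -/
def IsOddCycle {G : SimpleGraph V} (C : G.Subgraph) : Prop :=
  ∃ (v : V) (p : G.Walk v v), p.IsCycle ∧ Odd p.length ∧ p.toSubgraph = C

/-- `C` is an `M`-blossom with base `b`: an odd cycle of length `2k + 1` with exactly `k` edges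
in `M`, where `b` is the vertex of the cycle that is not covered by these `k` edges. -/
def IsBlossom {G : SimpleGraph V} (M C : G.Subgraph) (b : V) : Prop :=
  IsOddCycle C ∧
    C.edgeSet.ncard = 2 * (C.edgeSet ∩ M.edgeSet).ncard + 1 ∧
    b ∈ C.verts ∧ ∀ e ∈ C.edgeSet ∩ M.edgeSet, b ∉ e

/-- The path `p` from `b` to `r` is an `M`-stem: an `M`-alternating path of even (possibly zero)
length whose end `r` is not saturated by `M`. -/
def IsStem {G : SimpleGraph V} (M : G.Subgraph) {b r : V} (p : G.Walk b r) : Prop :=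
  p.IsPath ∧ Even p.length ∧ IsAlternatingWalk M p ∧ r ∉ M.support

/-- The blossom `C` with base `b` and the stem `p` form an `M`-flower with root `r`; the base is
the only common vertex of the blossom and the stem. -/
def IsFlower {G : SimpleGraph V} (M C : G.Subgraph) {b r : V} (p : G.Walk b r) : Prop :=
  IsBlossom M C b ∧ IsStem M p ∧ ∀ x, x ∈ C.verts → x ∈ p.support → x = b

/-- The reach set `R(C)`: the union of the vertex sets of all `M`-flowers with `M`-blossom `C`,
over all maximum matchings `M` of `G`. -/
def reach {G : SimpleGraph V} (C : G.Subgraph) : Set V :=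
  {x | ∃ (M : G.Subgraph) (b r : V) (p : G.Walk b r),
    IsMaximumMatching G M ∧ IsFlower M C p ∧ (x ∈ C.verts ∨ x ∈ p.support)}

/-- `G` is an `R`-disjoint graph: it has an odd cycle, every odd cycle has a nonempty reach set,
and the reach sets of distinct odd cycles are disjoint. -/
def IsRDisjoint (G : SimpleGraph V) : Prop :=
  (∃ C : G.Subgraph, IsOddCycle C) ∧
    (∀ C : G.Subgraph, IsOddCycle C → (reach C).Nonempty) ∧
    ∀ C C' : G.Subgraph, IsOddCycle C → IsOddCycle C' → C ≠ C' → Disjoint (reach C) (reach C')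

/-! ### Critical and maximum independent sets -/

/-- The neighborhood `N(X)`: all vertices adjacent to some vertex of `X`. -/
def nbhd (G : SimpleGraph V) (X : Finset V) : Set V :=
  {v | ∃ u ∈ X, G.Adj u v}

/-- The difference `d_G(X) = |X| - |N(X)|`. -/
noncomputable def diff (G : SimpleGraph V) (X : Finset V) : ℤ :=
  (X.card : ℤ) - ((nbhd G X).ncard : ℤ)

/-- `S` is a critical independent set: an independent set whose difference is the maximum of the
differences of all independent sets. -/
def IsCriticalIndepSet (G : SimpleGraph V) (S : Finset V) : Prop :=
  G.IsIndepSet (S : Set V) ∧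
    ∀ X : Finset V, G.IsIndepSet (X : Set V) → diff G X ≤ diff G S

/-- `ker(G)`: the intersection of all critical independent sets. -/
def ker (G : SimpleGraph V) : Set V :=
  ⋂ S ∈ {S : Finset V | IsCriticalIndepSet G S}, (S : Set V)

/-- `core(G)`: the intersection of all maximum independent sets. -/
def core [Finite V] (G : SimpleGraph V) : Set V :=
  ⋂ S ∈ {S : Finset V | G.IsMaximumIndepSet S}, (S : Set V)

end RDisjoint

/-!
Matchings are encoded as involutions of the vertex set, so that exchanging two matchings on a set
closed under both is a piecewise definition, and shifting an unsaturated vertex along an alternating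
path of length two is a conjugation by a transposition.

In an `R`-disjoint graph every odd cycle lies in its own reach set, so distinct odd cycles are
disjoint. The structural fact behind the theorem is that one maximum matching exposes all odd cycles
simultaneously: each odd cycle is a blossom with unsaturated base, and the bases can be prescribed
(`IsRDisjoint.exists_exposes_all`). To expose one more cycle `C` of a maximum matching `m`, take a
maximum matching `m'` exposing `C` and follow `m` and `m'` alternately from an edge of `m` leaving
`C`. The path cannot return to `C`, since this would give a second odd cycle meeting `C`; hence it
ends in a vertex unsaturated by `m`, and it is the stem of a flower with blossom `C`. The union of
these flowers is closed under both matchings and contained in the reach set of `C`, so replacing `m`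
by `m'` on it does not disturb the other odd cycles.

Let `E` be the set of vertices off the odd cycles left unsaturated by such a matching. Off the odd
cycles the graph is bipartite, and Hall's theorem yields an independent set of difference at least
`|E|` (`IsRDisjoint.exists_isIndepSet_le_diff`). Therefore every critical independent set `K`
contains `E`, for a suitable choice of bases, and the matching pairs `K \ E` with `N(K)`. The vertices
outside `K ∪ N(K)` other than the bases are perfectly matched among themselves and induce a bipartite
graph. Either colour class, added to `K`, gives an independent set that is maximum by
`IsRDisjoint.two_mul_card_le`, so each vertex outside `K` is missed by a maximum independent set, and
the core is contained in `K`. The reverse inclusion `ker_subset_core` holds in every graph, because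
the intersection of a critical and a maximum independent set is critical.
-/

namespace RDisjoint

variable {V : Type*}

/-! ### Matchings as involutions -/

/-- A matching of `G`, encoded as the involution of the vertex set that exchanges the ends of
each matching edge; its fixed points are the unsaturated vertices. -/
def IsMatchingPerm (G : SimpleGraph V) (m : Equiv.Perm V) : Prop :=
  (∀ v, m (m v) = v) ∧ ∀ v, m v ≠ v → G.Adj v (m v)

/-- The set of vertices left unsaturated by the matching `m`. -/
def fixedSet (m : Equiv.Perm V) : Set V := {v | m v = v}

/-- A maximum matching, encoded as an involution: one with the fewest unsaturated vertices. -/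
def IsMaxMatchingPerm (G : SimpleGraph V) (m : Equiv.Perm V) : Prop :=
  IsMatchingPerm G m ∧ ∀ m', IsMatchingPerm G m' → (fixedSet m).ncard ≤ (fixedSet m').ncard

theorem mem_fixedSet {m : Equiv.Perm V} {v : V} : v ∈ fixedSet m ↔ m v = v := Iff.rfl

/-- The subgraph whose edges are the edges of the matching `m`. -/
def matchingSubgraph (G : SimpleGraph V) (m : Equiv.Perm V) : G.Subgraph where
  verts := {v | m v ≠ v}
  Adj u v := G.Adj u v ∧ m u = v ∧ m v = u
  adj_sub h := h.1
  edge_vert := by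
    rintro u v ⟨h, h1, -⟩
    simpa [h1] using h.ne'
  symm := ⟨fun _ _ h => ⟨h.1.symm, h.2.2, h.2.1⟩⟩

theorem IsMatchingPerm.matchingSubgraph_adj {G : SimpleGraph V} {m : Equiv.Perm V}
    (hm : IsMatchingPerm G m) {u v : V} : (matchingSubgraph G m).Adj u v ↔ m u = v ∧ u ≠ v := by
  constructor
  · rintro ⟨h, h1, -⟩
    exact ⟨h1, h.ne⟩
  · rintro ⟨rfl, h⟩
    exact ⟨hm.2 u h.symm, rfl, hm.1 u⟩

theorem IsMatchingPerm.matchingSubgraph_isMatching {G : SimpleGraph V} {m : Equiv.Perm V}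
    (hm : IsMatchingPerm G m) : (matchingSubgraph G m).IsMatching := by
  intro v hv
  refine ⟨m v, hm.matchingSubgraph_adj.2 ⟨rfl, fun h => hv h.symm⟩, fun w hw => ?_⟩
  exact (hm.matchingSubgraph_adj.1 hw).1.symm

/-- Every matching is encoded by an involution. -/
theorem exists_isMatchingPerm {G : SimpleGraph V} {M : G.Subgraph} (hM : M.IsMatching) :
    ∃ m, IsMatchingPerm G m ∧ ∀ u v, M.Adj u v ↔ m u = v ∧ u ≠ v := by
  classical
  let f : V → V := fun v => if h : ∃ w, M.Adj v w then h.choose else v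
  have hf : ∀ u v, M.Adj u v → f u = v := by
    intro u v h
    have h' : ∃ w, M.Adj u w := ⟨v, h⟩
    have : f u = h'.choose := dif_pos h'
    rw [this]
    exact hM.eq_of_adj_left h'.choose_spec h
  have hf' : ∀ u, f u ≠ u → M.Adj u (f u) := by
    intro u h
    by_cases h' : ∃ w, M.Adj u w
    · obtain ⟨w, hw⟩ := h'
      rwa [hf u w hw]
    · exact absurd (dif_neg h') h
  have hinv : Function.Involutive f := by
    intro u
    by_cases h : f u = u
    · rw [h, h]
    · exact hf _ _ (hf' u h).symm
  refine ⟨hinv.toPerm, ⟨hinv, fun v h => (hf' v h).adj_sub⟩,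
    fun u v => ⟨fun h => ⟨hf u v h, h.ne⟩, ?_⟩⟩
  rintro ⟨rfl, h⟩
  exact hf' u h.symm

/-- Each vertex is an end of exactly one matching edge or is unsaturated. -/
theorem two_mul_ncard_edgeSet_add [Finite V] {G : SimpleGraph V} {M : G.Subgraph}
    {m : Equiv.Perm V} (h : ∀ u v, M.Adj u v ↔ m u = v ∧ u ≠ v) :
    2 * M.edgeSet.ncard + (fixedSet m).ncard = Nat.card V := by
  classical
  have := Fintype.ofFinite V
  have hdeg := M.spanningCoe.sum_degrees_eq_twice_card_edges
  have hE : M.edgeSet.ncard = M.spanningCoe.edgeFinset.card := by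
    rw [← SimpleGraph.Subgraph.edgeSet_spanningCoe, Set.ncard_eq_toFinset_card']
    rfl
  have hd : ∀ v, M.spanningCoe.degree v = if m v = v then 0 else 1 := by
    intro v
    have : M.spanningCoe.neighborFinset v = if m v = v then ∅ else {m v} := by
      ext w
      rw [SimpleGraph.mem_neighborFinset, SimpleGraph.Subgraph.spanningCoe_adj, h]
      split_ifs with h1
      · rw [h1]; simp
      · constructor
        · rintro ⟨rfl, -⟩; simp
        · intro hw
          rw [Finset.mem_singleton] at hw
          subst hw
          exact ⟨rfl, fun h2 => h1 h2.symm⟩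
    rw [← SimpleGraph.card_neighborFinset_eq_degree, this]
    split_ifs <;> simp
  have hF : (fixedSet m).ncard = (Finset.univ.filter fun v => m v = v).card := by
    rw [← Set.ncard_coe_finset]
    congr 1
    ext v
    simp [mem_fixedSet]
  simp_rw [hd] at hdeg
  rw [hE, ← hdeg, hF, Nat.card_eq_fintype_card, ← Finset.card_univ, Finset.card_filter,
    ← Finset.sum_add_distrib, Finset.card_eq_sum_ones]
  refine Finset.sum_congr rfl fun v _ => ?_
  split_ifs <;> rfl

theorem IsMaxMatchingPerm.isMaximumMatching [Finite V] {G : SimpleGraph V} {m : Equiv.Perm V}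
    (hm : IsMaxMatchingPerm G m) : IsMaximumMatching G (matchingSubgraph G m) := by
  refine ⟨hm.1.matchingSubgraph_isMatching, fun M hM => ?_⟩
  obtain ⟨m', hm', h⟩ := exists_isMatchingPerm hM
  have h1 := two_mul_ncard_edgeSet_add h
  have h2 := two_mul_ncard_edgeSet_add fun u v => hm.1.matchingSubgraph_adj (u := u) (v := v)
  have := hm.2 m' hm'
  omega

theorem exists_eq_matchingSubgraph {G : SimpleGraph V} {M : G.Subgraph} (hM : M.IsMatching) :
    ∃ m, IsMatchingPerm G m ∧ M = matchingSubgraph G m := by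
  obtain ⟨m, hm, h⟩ := exists_isMatchingPerm hM
  refine ⟨m, hm, SimpleGraph.Subgraph.ext ?_ ?_⟩
  · ext v
    rw [← hM.support_eq_verts, SimpleGraph.Subgraph.mem_support]
    constructor
    · rintro ⟨w, hw⟩
      obtain ⟨rfl, hne⟩ := (h v w).1 hw
      exact hne.symm
    · intro hv
      exact ⟨m v, (h _ _).2 ⟨rfl, fun h => hv h.symm⟩⟩
  · ext u v
    rw [h, hm.matchingSubgraph_adj]

theorem IsMaximumMatching.exists_eq_matchingSubgraph [Finite V] {G : SimpleGraph V}
    {M : G.Subgraph} (hM : IsMaximumMatching G M) :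
    ∃ m, IsMaxMatchingPerm G m ∧ M = matchingSubgraph G m := by
  obtain ⟨m, hm, rfl⟩ := RDisjoint.exists_eq_matchingSubgraph hM.1
  refine ⟨m, ⟨hm, fun m' hm' => ?_⟩, rfl⟩
  have h1 := two_mul_ncard_edgeSet_add fun u v => hm.matchingSubgraph_adj (u := u) (v := v)
  have h2 := two_mul_ncard_edgeSet_add fun u v => hm'.matchingSubgraph_adj (u := u) (v := v)
  have := hM.2 _ hm'.matchingSubgraph_isMatching
  omega

theorem exists_isMaxMatchingPerm [Finite V] (G : SimpleGraph V) :
    ∃ m, IsMaxMatchingPerm G m := by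
  have : {m : Equiv.Perm V | IsMatchingPerm G m}.Nonempty := ⟨1, by simp [IsMatchingPerm]⟩
  obtain ⟨m, hm, h⟩ := Set.exists_min_image _ (fun m => (fixedSet m).ncard) (Set.toFinite _) this
  exact ⟨m, hm, h⟩

/-! ### Modifying matchings -/

/-- Adding an edge between two unsaturated vertices. -/
theorem IsMatchingPerm.exists_add_edge [Finite V] {G : SimpleGraph V} {n : Equiv.Perm V}
    (hn : IsMatchingPerm G n) {a b : V} (ha : n a = a) (hb : n b = b) (hab : G.Adj a b) :
    ∃ n', IsMatchingPerm G n' ∧ fixedSet n' = fixedSet n \ {a, b} ∧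
      ∀ x, x ≠ a → x ≠ b → n' x = n x := by
  classical
  have hs : ∀ x, n x = a ↔ x = a := fun x =>
    ⟨fun h => by rw [← hn.1 x, h, ha], fun h => by rw [h, ha]⟩
  have hs' : ∀ x, n x = b ↔ x = b := fun x =>
    ⟨fun h => by rw [← hn.1 x, h, hb], fun h => by rw [h, hb]⟩
  have hoff : ∀ x, x ≠ a → x ≠ b → (n * Equiv.swap a b) x = n x := fun x h1 h2 => by
    simp [Equiv.swap_apply_of_ne_of_ne h1 h2]
  have hA : (n * Equiv.swap a b) a = b := by simp [hb]
  have hB : (n * Equiv.swap a b) b = a := by simp [ha]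
  refine ⟨n * Equiv.swap a b, ⟨fun x => ?_, fun x hx => ?_⟩, ?_, hoff⟩
  · by_cases h1 : x = a
    · rw [h1, hA, hB]
    by_cases h2 : x = b
    · rw [h2, hB, hA]
    rw [hoff x h1 h2, hoff _ (by rwa [Ne, hs]) (by rwa [Ne, hs']), hn.1]
  · by_cases h1 : x = a
    · rwa [h1, hA]
    by_cases h2 : x = b
    · rw [h2, hB]; exact hab.symm
    rw [hoff x h1 h2] at hx ⊢
    exact hn.2 x hx
  · ext x
    simp only [mem_fixedSet, Set.mem_sdiff, Set.mem_insert_iff, Set.mem_singleton_iff, not_or]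
    by_cases h1 : x = a
    · subst h1; rw [hA]; simp [hab.ne']
    by_cases h2 : x = b
    · subst h2; rw [hB]; simp [hab.ne]
    rw [hoff x h1 h2]; simp [h1, h2]

theorem IsMaxMatchingPerm.not_adj [Finite V] {G : SimpleGraph V} {n : Equiv.Perm V}
    (hn : IsMaxMatchingPerm G n) {a b : V} (ha : n a = a) (hb : n b = b) : ¬ G.Adj a b := by
  intro hab
  obtain ⟨n', hn', hf, -⟩ := hn.1.exists_add_edge ha hb hab
  have h1 := hn.2 n' hn'
  have h2 : (fixedSet n').ncard < (fixedSet n).ncard := by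
    refine Set.ncard_lt_ncard ?_ (Set.toFinite _)
    rw [hf]
    exact ⟨Set.sdiff_subset, fun h => (h (show a ∈ fixedSet n from ha)).2 (by simp)⟩
  omega

/-- Adding a family of disjoint edges between unsaturated vertices. -/
theorem IsMatchingPerm.exists_add_edges [Finite V] {G : SimpleGraph V} (A : Finset V) (g : V → V)
    (hg : Set.InjOn g A) {n : Equiv.Perm V} (hn : IsMatchingPerm G n)
    (hA : ∀ a ∈ A, n a = a ∧ n (g a) = g a ∧ G.Adj a (g a) ∧ g a ∉ A) :
    ∃ n', IsMatchingPerm G n' ∧ (fixedSet n').ncard + 2 * A.card = (fixedSet n).ncard := by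
  classical
  induction A using Finset.induction_on generalizing n with
  | empty => exact ⟨n, hn, by simp⟩
  | insert a A ha ih =>
    obtain ⟨h1, h2, h3, h4⟩ := hA a (Finset.mem_insert_self _ _)
    obtain ⟨n1, hn1, hf, hoff⟩ := hn.exists_add_edge h1 h2 h3
    have hA' : ∀ x ∈ A, n1 x = x ∧ n1 (g x) = g x ∧ G.Adj x (g x) ∧ g x ∉ A := by
      intro x hx
      obtain ⟨k1, k2, k3, k4⟩ := hA x (Finset.mem_insert_of_mem hx)
      have hxa : x ≠ a := by rintro rfl; exact ha hx
      refine ⟨?_, ?_, k3, fun h => k4 (Finset.mem_insert_of_mem h)⟩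
      · rw [hoff x hxa, k1]
        rintro rfl
        exact h4 (Finset.mem_insert_of_mem hx)
      · rw [hoff, k2]
        · intro h; exact k4 (h ▸ Finset.mem_insert_self _ _)
        · intro h
          exact hxa (hg (by simp [hx]) (by simp) h)
    obtain ⟨n', hn', hc⟩ := ih (hg.mono (by simp)) hn1 hA'
    refine ⟨n', hn', ?_⟩
    rw [Finset.card_insert_of_notMem ha]
    have h5 := Set.ncard_sdiff_add_ncard_of_subset (s := {a, g a}) (t := fixedSet n)
      (by
        rintro x (rfl | rfl)
        · exact h1
        · exact h2)
    rw [Set.ncard_pair h3.ne, ← hf] at h5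
    omega

/-- Sliding along an alternating path of length two: if `s` is unsaturated and adjacent to `y`,
and `y` is matched to `z`, then the edge `yz` can be replaced by `sy`. -/
theorem IsMaxMatchingPerm.exists_slide [Finite V] {G : SimpleGraph V} {n : Equiv.Perm V}
    (hn : IsMaxMatchingPerm G n) {s y : V} (hs : n s = s) (hsy : G.Adj s y) :
    ∃ n', IsMaxMatchingPerm G n' ∧ n' s = y ∧ n' y = s ∧ n' (n y) = n y ∧
      ∀ x, x ≠ s → x ≠ y → x ≠ n y → n' x = n x := by
  classical
  have hy : n y ≠ y := fun h => hn.not_adj hs h hsy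
  have hzs : n y ≠ s := fun h => by
    have := hn.1.1 y
    rw [h, hs] at this
    exact hsy.ne this
  set z := n y with hz
  have hnz : n z = y := hn.1.1 y
  have inj : ∀ x w, n x = w → x = n w := fun x w h => by rw [← h, hn.1.1]
  set n' : Equiv.Perm V := Equiv.swap s z * n * Equiv.swap s z with hn'
  have a1 : n' s = y := by
    simp [hn', hnz, Equiv.swap_apply_of_ne_of_ne hsy.ne' hy.symm]
  have a2 : n' y = s := by
    simp [hn', Equiv.swap_apply_of_ne_of_ne hsy.ne' hy.symm, ← hz]
  have a3 : n' z = z := by simp [hn', hs]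
  have a4 : ∀ x, x ≠ s → x ≠ y → x ≠ z → n' x = n x := by
    intro x h1 h2 h3
    have h4 : n x ≠ s := fun h => h1 (by rw [inj x s h, hs])
    have h5 : n x ≠ z := fun h => h2 (by rw [inj x z h, hnz])
    simp [hn', Equiv.swap_apply_of_ne_of_ne h1 h3, Equiv.swap_apply_of_ne_of_ne h4 h5]
  refine ⟨n', ⟨⟨fun x => ?_, fun x hx => ?_⟩, fun m' hm' => ?_⟩, a1, a2, a3, a4⟩
  · simp [hn', hn.1.1]
  · by_cases h1 : x = s
    · rwa [h1, a1]
    by_cases h2 : x = y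
    · rw [h2, a2]; exact hsy.symm
    by_cases h3 : x = z
    · exact absurd (h3 ▸ a3) hx
    rw [a4 x h1 h2 h3] at hx ⊢
    exact hn.1.2 x hx
  · have : fixedSet n' = Equiv.swap s z '' fixedSet n := by
      ext x
      rw [Equiv.image_eq_preimage_symm]
      simp only [mem_fixedSet, Set.mem_preimage, Equiv.symm_swap, hn', Equiv.Perm.mul_apply]
      rw [Equiv.swap_apply_eq_iff]
    rw [this, Set.ncard_image_of_injective _ (Equiv.injective _)]
    exact hn.2 m' hm'

/-- Replacing a matching inside a set that is closed under both matchings. -/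
theorem IsMatchingPerm.exists_piecewise {G : SimpleGraph V} {m m' : Equiv.Perm V}
    (hm : IsMatchingPerm G m) (hm' : IsMatchingPerm G m') {O : Set V}
    (hO : ∀ x ∈ O, m x ∈ O) (hO' : ∀ x ∈ O, m' x ∈ O) :
    ∃ n, IsMatchingPerm G n ∧ (∀ x ∈ O, n x = m' x) ∧ ∀ x ∉ O, n x = m x := by
  classical
  let f : V → V := fun x => if x ∈ O then m' x else m x
  have h1 : ∀ x ∈ O, f x = m' x := fun x hx => if_pos hx
  have h2 : ∀ x ∉ O, f x = m x := fun x hx => if_neg hx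
  have h3 : ∀ x ∉ O, m x ∉ O := fun x hx h => hx (by simpa [hm.1] using hO _ h)
  have hinv : Function.Involutive f := by
    intro x
    by_cases hx : x ∈ O
    · rw [h1 x hx, h1 _ (hO' x hx), hm'.1]
    · rw [h2 x hx, h2 _ (h3 x hx), hm.1]
  refine ⟨hinv.toPerm, ⟨hinv, fun v hv => ?_⟩, h1, h2⟩
  change f v ≠ v at hv
  change G.Adj v (f v)
  by_cases hx : v ∈ O
  · rw [h1 v hx] at hv ⊢; exact hm'.2 v hv
  · rw [h2 v hx] at hv ⊢; exact hm.2 v hv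

theorem ncard_fixedSet_piecewise [Finite V] {m m' n : Equiv.Perm V} {O : Set V}
    (h1 : ∀ x ∈ O, n x = m' x) (h2 : ∀ x ∉ O, n x = m x) :
    (fixedSet n).ncard = (fixedSet m' ∩ O).ncard + (fixedSet m \ O).ncard := by
  rw [← Set.ncard_inter_add_ncard_sdiff_eq_ncard (fixedSet n) O]
  congr 2 <;> ext x <;> simp only [Set.mem_inter_iff, Set.mem_sdiff, mem_fixedSet] <;>
    refine and_congr_left fun hx => ?_
  · rw [h1 x hx]
  · rw [h2 x hx]

/-- Two maximum matchings may be combined along a set that is closed under both. -/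
theorem IsMaxMatchingPerm.exists_piecewise [Finite V] {G : SimpleGraph V} {m m' : Equiv.Perm V}
    (hm : IsMaxMatchingPerm G m) (hm' : IsMaxMatchingPerm G m') {O : Set V}
    (hO : ∀ x ∈ O, m x ∈ O) (hO' : ∀ x ∈ O, m' x ∈ O) :
    ∃ n, IsMaxMatchingPerm G n ∧ (∀ x ∈ O, n x = m' x) ∧ ∀ x ∉ O, n x = m x := by
  obtain ⟨n, hn, h1, h2⟩ := hm.1.exists_piecewise hm'.1 hO hO'
  obtain ⟨k, hk, k1, k2⟩ := hm'.1.exists_piecewise hm.1 hO' hO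
  refine ⟨n, ⟨hn, fun l hl => ?_⟩, h1, h2⟩
  have e1 := ncard_fixedSet_piecewise h1 h2
  have e2 := ncard_fixedSet_piecewise k1 k2
  have e3 := Set.ncard_inter_add_ncard_sdiff_eq_ncard (fixedSet m) O
  have e4 := Set.ncard_inter_add_ncard_sdiff_eq_ncard (fixedSet m') O
  have := hm'.2 k hk
  have := hm.2 k hk
  have := hm.2 l hl
  omega

/-! ### Odd cycles and colourings -/

/-- A closed walk of odd length contains an odd cycle. -/
theorem exists_isOddCycle_of_odd_walk {G : SimpleGraph V} {u : V} (w : G.Walk u u)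
    (hw : Odd w.length) : ∃ C : G.Subgraph, IsOddCycle C ∧ ∀ x ∈ C.verts, x ∈ w.support := by
  induction hN : w.length using Nat.strong_induction_on generalizing u with
  | _ N ih =>
  subst hN
  cases w with
  | nil => simp at hw
  | @cons _ v _ h p =>
    rw [SimpleGraph.Walk.length_cons] at hw
    have hp : Even p.length := by
      rcases Nat.even_or_odd p.length with h' | h'
      · exact h'
      · exact absurd h'.add_one (by simpa using hw)
    by_cases hpath : p.IsPath
    · refine ⟨_, ⟨u, SimpleGraph.Walk.cons h p, ?_, by simpa using hw, rfl⟩, fun x hx =>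
        (SimpleGraph.Walk.mem_verts_toSubgraph _).1 hx⟩
      rw [SimpleGraph.Walk.cons_isCycle_iff]
      refine ⟨hpath, fun he => ?_⟩
      have := hpath.length_eq_one_of_mem_edges (by rwa [Sym2.eq_swap])
      rw [this] at hp
      exact absurd hp (by decide)
    · rw [SimpleGraph.Walk.isPath_iff_isSubwalk_imp_nil] at hpath
      push Not at hpath
      obtain ⟨y, q, ⟨a, b, hab⟩, hq⟩ := hpath
      have hq' : 0 < q.length := by
        rw [SimpleGraph.Walk.not_nil_iff_lt_length] at hq
        exact hq
      have hlen : p.length = a.length + q.length + b.length := by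
        rw [hab]; simp
      rcases Nat.even_or_odd q.length with he | ho
      · obtain ⟨C, hC, hs⟩ := ih ((SimpleGraph.Walk.cons h (a.append b)).length)
          (by simp; omega) (SimpleGraph.Walk.cons h (a.append b)) (by
            simp only [SimpleGraph.Walk.length_cons, SimpleGraph.Walk.length_append]
            rw [hlen] at hp
            have : Even (a.length + b.length) := by
              by_contra hc
              rw [Nat.not_even_iff_odd] at hc
              exact absurd hp (by rw [Nat.not_even_iff_odd, add_right_comm]; exact hc.add_even he)
            exact this.add_one) rfl
        refine ⟨C, hC, fun x hx => ?_⟩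
        have := hs x hx
        simp only [SimpleGraph.Walk.support_cons, List.mem_cons,
          SimpleGraph.Walk.mem_support_append_iff, hab] at this ⊢
        tauto
      · obtain ⟨C, hC, hs⟩ := ih q.length (by simp; omega) q ho rfl
        refine ⟨C, hC, fun x hx => ?_⟩
        have := hs x hx
        simp only [SimpleGraph.Walk.support_cons, List.mem_cons,
          SimpleGraph.Walk.mem_support_append_iff, hab] at this ⊢
        tauto

/-- Deleting a set of vertices that meets every odd cycle leaves a bipartite graph. -/
theorem exists_coloring_off {G : SimpleGraph V} {T : Set V}
    (hT : ∀ C : G.Subgraph, IsOddCycle C → ∃ x ∈ C.verts, x ∈ T) :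
    ∃ κ : V → Bool, ∀ u v, u ∉ T → v ∉ T → G.Adj u v → κ u ≠ κ v := by
  let H : SimpleGraph V :=
    { Adj := fun u v => G.Adj u v ∧ u ∉ T ∧ v ∉ T
      symm := ⟨fun _ _ h => ⟨h.1.symm, h.2.2, h.2.1⟩⟩
      loopless := ⟨fun _ h => h.1.ne rfl⟩ }
  have hle : H ≤ G := fun _ _ h => h.1
  have hc : H.Colorable 2 := by
    rw [SimpleGraph.two_colorable_iff_forall_loop_even]
    intro u w
    by_contra hw
    rw [Nat.not_even_iff_odd] at hw
    obtain ⟨C, ⟨v, p, hp, ho, rfl⟩, -⟩ := exists_isOddCycle_of_odd_walk w hw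
    obtain ⟨x, hx, hxT⟩ := hT _ ⟨v, p.mapLe hle, (SimpleGraph.Walk.isCycle_mapLe hle).2 hp,
      by simpa using ho, rfl⟩
    have hx' : x ∈ p.support := by simpa using hx
    obtain ⟨y, hy⟩ : ∃ y, H.Adj x y := by
      by_contra hcon
      push Not at hcon
      have h1 : ((p.toSubgraph).neighborSet x).ncard = 2 :=
        hp.ncard_neighborSet_toSubgraph_eq_two hx'
      have h2 : (p.toSubgraph).neighborSet x = ∅ := by
        ext y
        simp only [SimpleGraph.Subgraph.mem_neighborSet, Set.mem_empty_iff_false, iff_false]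
        exact fun h => hcon y h.adj_sub
      simp [h2] at h1
    exact hy.2.1 hxT
  obtain ⟨c⟩ := hc
  refine ⟨fun v => decide (c v = 0), fun u v hu hv huv h =>
    c.valid (v := u) (w := v) ⟨huv, hu, hv⟩ ?_⟩
  have h' : c u = 0 ↔ c v = 0 := by simpa using h
  generalize c u = x at *
  generalize c v = y at *
  revert x y
  decide

/-- An odd cycle can be traversed from any of its vertices. -/
theorem IsOddCycle.exists_walk {G : SimpleGraph V} {C : G.Subgraph} (hC : IsOddCycle C) {b : V}
    (hb : b ∈ C.verts) : ∃ q : G.Walk b b, q.IsCycle ∧ Odd q.length ∧ q.toSubgraph = C := by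
  classical
  obtain ⟨v, p, hp, ho, rfl⟩ := hC
  have hb' : b ∈ p.support := by simpa using hb
  exact ⟨p.rotate b hb', hp.rotate hb', by simpa using ho, p.toSubgraph_rotate hb'⟩

theorem IsOddCycle.verts_nonempty {G : SimpleGraph V} {C : G.Subgraph} (hC : IsOddCycle C) :
    C.verts.Nonempty := by
  obtain ⟨v, p, hp, ho, rfl⟩ := hC
  exact ⟨v, by simp⟩

theorem IsOddCycle.exists_adj {G : SimpleGraph V} {C : G.Subgraph} (hC : IsOddCycle C) {b : V}
    (hb : b ∈ C.verts) : ∃ y, C.Adj b y := by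
  obtain ⟨q, hq, ho, rfl⟩ := hC.exists_walk hb
  exact ⟨_, q.toSubgraph_adj_snd hq.not_nil⟩

/-- The matching `m` restricted to the cycle `C` covers every vertex of `C` but `b`, by edges of
`C`, and leaves `b` unsaturated. -/
def Exposes {G : SimpleGraph V} (m : Equiv.Perm V) (C : G.Subgraph) (b : V) : Prop :=
  b ∈ C.verts ∧ m b = b ∧ ∀ x ∈ C.verts, x ≠ b → C.Adj x (m x)

theorem Exposes.mem {G : SimpleGraph V} {m : Equiv.Perm V} {C : G.Subgraph} {b : V}
    (h : Exposes m C b) {x : V} (hx : x ∈ C.verts) : m x ∈ C.verts := by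
  by_cases hxb : x = b
  · rw [hxb, h.2.1]; exact h.1
  · exact (h.2.2 x hx hxb).snd_mem

theorem Exposes.eq_base {G : SimpleGraph V} {m : Equiv.Perm V} {C : G.Subgraph} {b : V}
    (h : Exposes m C b) {x : V} (hx : x ∈ C.verts) (hm : m x = x) : x = b := by
  by_contra hxb
  have := h.2.2 x hx hxb
  rw [hm] at this
  exact this.ne rfl

/-- For each vertex of an odd cycle there is a matching of the cycle that misses only this vertex. -/
theorem IsOddCycle.exists_exposes {G : SimpleGraph V} {C : G.Subgraph} (hC : IsOddCycle C) {b : V}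
    (hb : b ∈ C.verts) : ∃ m : Equiv.Perm V, IsMatchingPerm G m ∧ Exposes m C b ∧
      ∀ x ∉ C.verts, m x = x := by
  classical
  obtain ⟨q, hq, ho, rfl⟩ := hC.exists_walk hb
  -- The vertices `1, …, 2k` along the cycle are matched in consecutive pairs.
  -- Indices start at the base, and `idx` is the position of a vertex on the cycle.
  let σ : ℕ → ℕ := fun i => if i = 0 then 0 else if i % 2 = 1 then i + 1 else i - 1
  let idx : V → ℕ := fun x => q.support.idxOf x
  have h4 : idx b = 0 := by
    change q.support.idxOf b = 0
    rw [← q.cons_tail_support]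
    exact List.idxOf_cons_self
  have hidx : ∀ x ∈ q.support, idx x < q.length ∧ q.getVert (idx x) = x := by
    intro x hx
    refine ⟨?_, q.getVert_support_idxOf hx⟩
    have h1 : idx x ≤ q.length := by
      have := List.idxOf_lt_length_of_mem hx
      rw [SimpleGraph.Walk.length_support] at this
      exact Nat.lt_succ_iff.1 this
    refine lt_of_le_of_ne h1 fun h2 => ?_
    have h3 : x = b := by
      rw [← q.getVert_support_idxOf hx]
      change q.getVert (idx x) = b
      rw [h2, q.getVert_length]
    rw [h3, h4] at h2
    rw [← h2] at ho
    exact absurd ho (by decide)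
  have hidx' : ∀ i < q.length, idx (q.getVert i) = i := by
    intro i hi
    have h1 := hidx _ (q.getVert_mem_support i)
    exact hq.getVert_injOn' (by simp; omega) (by simp; omega) h1.2
  have hσ : ∀ i < q.length, σ i < q.length ∧ σ (σ i) = i := by
    intro i hi
    obtain ⟨k, hk⟩ := ho
    have s0 : σ 0 = 0 := rfl
    have s1 : ∀ j, j % 2 = 1 → σ j = j + 1 := fun j hj => by
      simp only [σ]; rw [if_neg (by omega), if_pos hj]
    have s2 : ∀ j, j ≠ 0 → j % 2 = 0 → σ j = j - 1 := fun j h0 hj => by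
      simp only [σ]; rw [if_neg h0, if_neg (by omega)]
    rcases Nat.eq_zero_or_pos i with rfl | hpos
    · rw [s0, s0]; exact ⟨hi, rfl⟩
    rcases Nat.mod_two_eq_zero_or_one i with h | h
    · rw [s2 i (by omega) h, s1 (i - 1) (by omega)]; omega
    · rw [s1 i h, s2 (i + 1) (by omega) (by omega)]; omega
  let f : V → V := fun x => if x ∈ q.support then q.getVert (σ (idx x)) else x
  have hf1 : ∀ x ∈ q.support, f x = q.getVert (σ (idx x)) := fun x hx => if_pos hx
  have hf2 : ∀ x ∉ q.support, f x = x := fun x hx => if_neg hx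
  have hinv : Function.Involutive f := by
    intro x
    by_cases hx : x ∈ q.support
    · rw [hf1 x hx, hf1 _ (q.getVert_mem_support _), hidx' _ (hσ _ (hidx x hx).1).1,
        (hσ _ (hidx x hx).1).2, (hidx x hx).2]
    · rw [hf2 x hx, hf2 x hx]
  have hadj : ∀ x ∈ q.support, x ≠ b → q.toSubgraph.Adj x (f x) := by
    intro x hx hxb
    have h1 := hidx x hx
    have h0 : idx x ≠ 0 := by
      intro h
      rw [h, q.getVert_zero] at h1
      exact hxb h1.2.symm
    have h2 := (hσ _ h1.1).1
    rw [hf1 x hx]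
    by_cases hodd : idx x % 2 = 1
    · have h3 : σ (idx x) = idx x + 1 := by simp [σ, h0, hodd]
      rw [h3]
      have := q.toSubgraph_adj_getVert h1.1
      rwa [h1.2] at this
    · have h3 : σ (idx x) = idx x - 1 := by simp [σ, h0, hodd]
      rw [h3]
      have := q.toSubgraph_adj_getVert (i := idx x - 1) (by omega)
      rw [show idx x - 1 + 1 = idx x by omega, h1.2] at this
      exact this.symm
  have hfb : f b = b := by
    rw [hf1 b q.start_mem_support, h4]
    simp [σ]
  have hsupp : ∀ x, x ∈ q.toSubgraph.verts ↔ x ∈ q.support := fun x => by simp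
  refine ⟨hinv.toPerm, ⟨hinv, fun v hv => ?_⟩, ⟨hb, hfb, fun x hx => hadj x ((hsupp x).1 hx)⟩,
    fun x hx => hf2 x (by rwa [hsupp] at hx)⟩
  change f v ≠ v at hv
  change G.Adj v (f v)
  have hv' : v ∈ q.support := by
    by_contra h
    exact hv (hf2 v h)
  exact (hadj v hv' (by rintro rfl; exact hv hfb)).adj_sub

/-- The base of an exposed odd cycle may be moved to any other vertex of the cycle. -/
theorem IsMaxMatchingPerm.exists_rebase [Finite V] {G : SimpleGraph V} {m : Equiv.Perm V}
    (hm : IsMaxMatchingPerm G m) {C : G.Subgraph} (hC : IsOddCycle C) {b c : V}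
    (hb : Exposes m C b) (hc : c ∈ C.verts) :
    ∃ n, IsMaxMatchingPerm G n ∧ Exposes n C c ∧ ∀ x ∉ C.verts, n x = m x := by
  obtain ⟨k, hk, hkc, -⟩ := hC.exists_exposes hc
  obtain ⟨n, hn, h1, h2⟩ := hm.1.exists_piecewise hk (O := C.verts) (fun x => hb.mem)
    (fun x => hkc.mem)
  refine ⟨n, ⟨hn, fun l hl => ?_⟩, ⟨hc, by rw [h1 c hc, hkc.2.1], fun x hx hxc => ?_⟩, h2⟩
  · refine le_trans (le_of_eq ?_) (hm.2 l hl)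
    rw [ncard_fixedSet_piecewise h1 h2, ← Set.ncard_inter_add_ncard_sdiff_eq_ncard (fixedSet m) C.verts]
    congr 1
    have e1 : fixedSet k ∩ C.verts = {c} := by
      ext x
      exact ⟨fun h => hkc.eq_base h.2 h.1, fun h => h ▸ ⟨hkc.2.1, hc⟩⟩
    have e2 : fixedSet m ∩ C.verts = {b} := by
      ext x
      exact ⟨fun h => hb.eq_base h.2 h.1, fun h => h ▸ ⟨hb.2.1, hb.1⟩⟩
    rw [e1, e2]; simp
  · rw [h1 x hx]; exact hkc.2.2 x hx hxc

/-! ### Blossoms -/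

theorem IsOddCycle.ncard_edgeSet {G : SimpleGraph V} {C : G.Subgraph} (hC : IsOddCycle C) :
    C.edgeSet.ncard = C.verts.ncard := by
  classical
  obtain ⟨v, p, hp, ho, rfl⟩ := hC
  have h1 : p.toSubgraph.edgeSet = (p.edges.toFinset : Set (Sym2 V)) := by
    ext e; simp
  have h2 : p.toSubgraph.verts = (p.support.tail.toFinset : Set V) := by
    ext x
    simp only [SimpleGraph.Walk.mem_verts_toSubgraph, List.coe_toFinset, Set.mem_ofPred_eq]
    refine ⟨fun h => ?_, List.mem_of_mem_tail⟩
    rw [← p.cons_tail_support, List.mem_cons] at h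
    rcases h with rfl | h
    · exact p.end_mem_tail_support hp.not_nil
    · exact h
  rw [h1, h2, Set.ncard_coe_finset, Set.ncard_coe_finset,
    List.toFinset_card_of_nodup hp.isTrail.edges_nodup,
    List.toFinset_card_of_nodup hp.support_nodup]
  simp

theorem two_mul_ncard_inter_edgeSet [Finite V] {G : SimpleGraph V} (C : G.Subgraph)
    {m : Equiv.Perm V} (hm : IsMatchingPerm G m) :
    2 * (C.edgeSet ∩ (matchingSubgraph G m).edgeSet).ncard = {x | C.Adj x (m x)}.ncard := by
  let N : G.Subgraph :=
    { verts := {x | C.Adj x (m x)}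
      Adj := fun u v => C.Adj u v ∧ (matchingSubgraph G m).Adj u v
      adj_sub := fun h => h.1.adj_sub
      edge_vert := by
        rintro u v ⟨h, h1, rfl, -⟩
        exact h
      symm := ⟨fun _ _ h => ⟨h.1.symm, h.2.symm⟩⟩ }
  have hN : N.IsMatching := by
    intro v hv
    refine ⟨m v, ⟨hv, hm.matchingSubgraph_adj.2 ⟨rfl, hv.ne⟩⟩, fun w hw => ?_⟩
    exact (hm.matchingSubgraph_adj.1 hw.2).1.symm
  obtain ⟨k, hk, h⟩ := exists_isMatchingPerm hN
  have h1 := two_mul_ncard_edgeSet_add h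
  have h2 : N.edgeSet = C.edgeSet ∩ (matchingSubgraph G m).edgeSet := by
    ext e
    induction e using Sym2.ind
    rfl
  have h3 : fixedSet k = {x | C.Adj x (m x)}ᶜ := by
    ext x
    simp only [mem_fixedSet, Set.mem_compl_iff, Set.mem_ofPred_eq]
    constructor
    · intro hx hadj
      have := (h x (m x)).1 ⟨hadj, hm.matchingSubgraph_adj.2 ⟨rfl, hadj.ne⟩⟩
      rw [hx] at this
      exact this.2 this.1
    · intro hx
      by_contra hne
      obtain ⟨a1, a2⟩ := (h x (k x)).2 ⟨rfl, Ne.symm hne⟩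
      rw [← (hm.matchingSubgraph_adj.1 a2).1] at a1
      exact hx a1
  rw [h2, h3] at h1
  have h4 := Set.ncard_add_ncard_compl {x | C.Adj x (m x)}
  omega

/-- By counting, a blossom is covered by its matching edges up to its base. -/
theorem IsBlossom.adj [Finite V] {G : SimpleGraph V} {C : G.Subgraph} {m : Equiv.Perm V}
    (hm : IsMatchingPerm G m) {b : V} (h : IsBlossom (matchingSubgraph G m) C b) :
    ∀ x ∈ C.verts, x ≠ b → C.Adj x (m x) := by
  obtain ⟨hC, hcard, hb, hbe⟩ := h
  have h1 := two_mul_ncard_inter_edgeSet C hm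
  rw [hC.ncard_edgeSet] at hcard
  have hsub : {x | C.Adj x (m x)} ⊆ C.verts \ {b} := by
    intro x hx
    refine ⟨hx.fst_mem, ?_⟩
    rintro rfl
    exact hbe s(x, m x) ⟨hx, hm.matchingSubgraph_adj.2 ⟨rfl, hx.ne⟩⟩ (by simp)
  have h2 := Set.ncard_sdiff_singleton_add_one hb
  have h3 := Set.eq_of_subset_of_ncard_le hsub (by omega)
  intro x hx hxb
  have : x ∈ C.verts \ {b} := ⟨hx, hxb⟩
  rw [← h3] at this
  exact this

theorem isBlossom_of_adj [Finite V] {G : SimpleGraph V} {C : G.Subgraph} (hC : IsOddCycle C)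
    {m : Equiv.Perm V} (hm : IsMatchingPerm G m) {b : V} (hb : b ∈ C.verts)
    (hmb : m b ∉ C.verts ∨ m b = b) (h : ∀ x ∈ C.verts, x ≠ b → C.Adj x (m x)) :
    IsBlossom (matchingSubgraph G m) C b := by
  have hnb : ¬ C.Adj b (m b) := by
    intro hadj
    rcases hmb with h1 | h1
    · exact h1 hadj.snd_mem
    · rw [h1] at hadj; exact hadj.ne rfl
  have h1 := two_mul_ncard_inter_edgeSet C hm
  have h3 : {x | C.Adj x (m x)} = C.verts \ {b} := by
    ext x
    constructor
    · intro hx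
      refine ⟨hx.fst_mem, ?_⟩
      rintro rfl
      exact hnb hx
    · rintro ⟨hx, hxb⟩
      exact h x hx hxb
  refine ⟨hC, ?_, hb, ?_⟩
  · have h2 := Set.ncard_sdiff_singleton_add_one hb
    rw [h3] at h1
    rw [hC.ncard_edgeSet]
    omega
  · rintro e ⟨he, hem⟩ hbe
    obtain ⟨y, rfl⟩ := Sym2.mem_iff_exists.1 hbe
    have hy : m b = y := (hm.matchingSubgraph_adj.1 hem).1
    subst hy
    exact hnb he

/-! ### Sliding along stems -/

/-- A nontrivial stem starts with a matching edge, and exchanging matching and nonmatching edges along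
it leaves its start unsaturated. -/
theorem IsMaxMatchingPerm.exists_slide_stem [Finite V] {G : SimpleGraph V} {m : Equiv.Perm V}
    (hm : IsMaxMatchingPerm G m) {b r : V} (p : G.Walk b r) (hp : p.IsPath) (he : Even p.length)
    (ha : IsAlternatingWalk (matchingSubgraph G m) p) (hr : m r = r) :
    (0 < p.length → m b = p.snd) ∧
    ∃ n, IsMaxMatchingPerm G n ∧ n b = b ∧ ∀ x ∉ p.support, n x = m x := by
  induction hN : p.length using Nat.strong_induction_on generalizing b with
  | _ N ih =>
  subst hN
  match p, hp, he, ha with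
  | .nil, _, _, _ => exact ⟨by simp, m, hm, hr, fun _ _ => rfl⟩
  | .cons _ .nil, _, he, _ => simp at he
  | .cons (v := x) h1 (.cons (v := y) h2 q), hp, he, ha =>
    have he' : Even q.length := by
      simp only [SimpleGraph.Walk.length_cons] at he
      simpa [parity_simps] using he
    simp only [SimpleGraph.Walk.cons_isPath_iff, SimpleGraph.Walk.support_cons,
      List.mem_cons, not_or] at hp
    obtain ⟨⟨hq, hxq⟩, hbx, hbq⟩ := hp
    unfold IsAlternatingWalk at ha
    simp only [SimpleGraph.Walk.edges_cons, List.isChain_cons_cons] at ha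
    have ha' : IsAlternatingWalk (matchingSubgraph G m) q := ha.2.of_cons
    obtain ⟨hfst, n, hn, hny, hoff⟩ := ih q.length (by simp) q hq he' ha' rfl
    -- The second edge is not in the matching: it is the last one, ending in an unsaturated
    -- vertex, or the edge after it is in the matching.
    have hxy : m x ≠ y := by
      intro hxy
      have hxm : m y = x := by rw [← hxy, hm.1.1]
      match q, hq, hxq, hfst with
      | .nil, _, hxq, _ =>
        rw [hr] at hxm
        simp [hxm] at hxq
      | .cons (v := w) h3 q', hq, hxq, hfst =>
        have := hfst (by simp)
        rw [hxm] at this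
        simp only [SimpleGraph.Walk.snd_cons] at this
        subst this
        simp at hxq
    have h2' : s(x, y) ∉ (matchingSubgraph G m).edgeSet := fun h =>
      hxy (hm.1.matchingSubgraph_adj.1 h).1
    have hbxM : m b = x := by
      rcases ha.1 with h | h
      · exact (hm.1.matchingSubgraph_adj.1 h.1).1
      · exact absurd h.1 h2'
    refine ⟨fun _ => by simpa using hbxM, ?_⟩
    have hnx : n x = b := by rw [hoff x hxq, ← hbxM, hm.1.1]
    obtain ⟨n', hn', a1, a2, a3, a4⟩ := hn.exists_slide hny h2.symm
    refine ⟨n', hn', by rwa [hnx] at a3, fun z hz => ?_⟩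
    simp only [SimpleGraph.Walk.support_cons, List.mem_cons, not_or] at hz
    rw [a4 z, hoff z hz.2.2]
    · rintro rfl; exact hz.2.2 q.start_mem_support
    · exact hz.2.1
    · rw [hnx]; exact hz.1

/-- The blossom of a flower of a maximum matching is exposed by another maximum matching. -/
theorem exists_exposes_of_reach_nonempty [Finite V] {G : SimpleGraph V} {C : G.Subgraph}
    (h : (reach C).Nonempty) : ∃ m b, IsMaxMatchingPerm G m ∧ Exposes m C b := by
  obtain ⟨-, M, b, r, p, hM, ⟨hB, ⟨hp, he, ha, hr⟩, hint⟩, -⟩ := h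
  obtain ⟨m, hm, rfl⟩ := hM.exists_eq_matchingSubgraph
  have hr' : m r = r := by
    by_contra hne
    exact hr ((SimpleGraph.Subgraph.mem_support _).2
      ⟨m r, hm.1.matchingSubgraph_adj.2 ⟨rfl, Ne.symm hne⟩⟩)
  obtain ⟨-, n, hn, hnb, hoff⟩ := hm.exists_slide_stem p hp he ha hr'
  refine ⟨n, b, hn, hB.2.2.1, hnb, fun x hx hxb => ?_⟩
  rw [hoff x fun h => hxb (hint x hx h)]
  exact hB.adj hm.1 x hx hxb

/-! ### Growing a flower -/

/-- A flower of the maximum matching `n` with blossom `C`, base `c` and stem the reverse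
of `w`. -/
structure IsGrownFlower {G : SimpleGraph V} (n : Equiv.Perm V) (C : G.Subgraph) {r c : V}
    (w : G.Walk r c) : Prop where
  isMax : IsMaxMatchingPerm G n
  base_mem : c ∈ C.verts
  base : n c ∉ C.verts ∨ n c = c
  adj : ∀ x ∈ C.verts, x ≠ c → C.Adj x (n x)
  isPath : w.IsPath
  even : Even w.length
  alt : IsAlternatingWalk (matchingSubgraph G n) w
  root : n r = r
  inter : ∀ x ∈ C.verts, x ∈ w.support → x = c

theorem IsGrownFlower.mem_reach [Finite V] {G : SimpleGraph V} {n : Equiv.Perm V}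
    {C : G.Subgraph} {r c : V} {w : G.Walk r c} (h : IsGrownFlower n C w) (hC : IsOddCycle C)
    {x : V} (hx : x ∈ C.verts ∨ x ∈ w.support) : x ∈ reach C := by
  refine ⟨matchingSubgraph G n, c, r, w.reverse, h.isMax.isMaximumMatching,
    ⟨isBlossom_of_adj hC h.isMax.1 h.base_mem h.base h.adj,
      ⟨h.isPath.reverse, by simpa using h.even, ?_, ?_⟩, ?_⟩, by simpa using hx⟩
  · unfold IsAlternatingWalk
    rw [SimpleGraph.Walk.edges_reverse, List.isChain_reverse]
    exact h.alt.imp fun e f hef => by rwa [xor_comm]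
  · rw [SimpleGraph.Subgraph.mem_support]
    rintro ⟨y, hy⟩
    obtain ⟨h1, h2⟩ := h.isMax.1.matchingSubgraph_adj.1 hy
    exact h2 (by rw [← h1, h.root])
  · intro x hx hxs
    exact h.inter x hx (by simpa using hxs)

theorem isGrownFlower_nil {G : SimpleGraph V} {n : Equiv.Perm V}
    {C : G.Subgraph} {c : V} (hn : IsMaxMatchingPerm G n) (h : Exposes n C c) :
    IsGrownFlower n C (SimpleGraph.Walk.nil : G.Walk c c) where
  isMax := hn
  base_mem := h.1
  base := Or.inr h.2.1
  adj := h.2.2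
  isPath := by simp
  even := by simp
  alt := by simp [IsAlternatingWalk]
  root := h.2.1
  inter := by simp

theorem IsRDisjoint.subset_reach [Finite V] {G : SimpleGraph V} (hG : IsRDisjoint G)
    {C : G.Subgraph} (hC : IsOddCycle C) : C.verts ⊆ reach C := by
  obtain ⟨-, M, b, r, p, hM, hF, -⟩ := hG.2.1 C hC
  exact fun x hx => ⟨M, b, r, p, hM, hF, Or.inl hx⟩

theorem IsRDisjoint.eq_of_mem_reach {G : SimpleGraph V} (hG : IsRDisjoint G)
    {C C' : G.Subgraph} (hC : IsOddCycle C) (hC' : IsOddCycle C') {x : V} (hx : x ∈ reach C)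
    (hx' : x ∈ reach C') : C = C' := by
  by_contra hne
  exact Set.disjoint_left.1 (hG.2.2 C C' hC hC' hne) hx hx'

theorem IsRDisjoint.eq_of_mem [Finite V] {G : SimpleGraph V} (hG : IsRDisjoint G)
    {C C' : G.Subgraph} (hC : IsOddCycle C) (hC' : IsOddCycle C') {x : V} (hx : x ∈ C.verts)
    (hx' : x ∈ C'.verts) : C = C' :=
  hG.eq_of_mem_reach hC hC' (hG.subset_reach hC hx) (hG.subset_reach hC' hx')

/-- A nontrivial path of even length that leaves an odd cycle `C` does not return to another vertex
of `C`: closing it up along the arc of `C` of the right parity would give a second odd cycle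
through a vertex of `C`. -/
theorem IsRDisjoint.not_adj_of_path [Finite V] {G : SimpleGraph V} (hG : IsRDisjoint G)
    {C : G.Subgraph} (hC : IsOddCycle C) {r c y : V} (w : G.Walk r c) (hw : w.IsPath)
    (he : Even w.length) (hpos : 0 < w.length) (hint : ∀ x ∈ C.verts, x ∈ w.support → x = c)
    (hc : c ∈ C.verts) (hy : y ∈ C.verts) (hyc : y ≠ c) : ¬ G.Adj r y := by
  classical
  intro hry
  have hrc : r ≠ c := by
    rintro rfl
    rw [SimpleGraph.Walk.length_eq_zero_iff.2 (w.isPath_iff_nil.1 hw)] at hpos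
    exact hpos.false
  have hrC : r ∉ C.verts := fun h => hrc (hint r h w.start_mem_support)
  -- An arc of even length from `c` to `y`.
  obtain ⟨q, hq, hqe, hqs⟩ : ∃ q : G.Walk c y, q.IsPath ∧ Even q.length ∧
      ∀ x ∈ q.support, x ∈ C.verts := by
    obtain ⟨q, hq, ho, rfl⟩ := hC.exists_walk hc
    have hy' : y ∈ q.support := by simpa using hy
    have hsum : (q.takeUntil y hy').length + (q.dropUntil y hy').length = q.length := by
      rw [← SimpleGraph.Walk.length_append, q.take_spec hy']
    rcases Nat.even_or_odd (q.takeUntil y hy').length with h | h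
    · refine ⟨q.takeUntil y hy', hq.isPath_takeUntil hy', h, fun x hx => ?_⟩
      simpa using q.support_takeUntil_subset_support hy' hx
    · refine ⟨(q.dropUntil y hy').reverse, ?_, ?_, fun x hx => ?_⟩
      · rw [SimpleGraph.Walk.isPath_reverse_iff]
        have hq' := hq
        rw [← q.take_spec hy'] at hq'
        exact hq'.isPath_of_append_right (SimpleGraph.Walk.not_nil_of_ne hyc.symm)
      · rw [SimpleGraph.Walk.length_reverse]
        rw [← hsum] at ho
        by_contra hc'
        rw [Nat.not_even_iff_odd] at hc'
        exact absurd ho (by rw [Nat.not_odd_iff_even]; exact h.add_odd hc')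
      · simpa using q.support_dropUntil_subset_support hy' (by simpa using hx)
  have hpath : (w.append q).IsPath := by
    apply SimpleGraph.Walk.IsPath.mk'
    rw [SimpleGraph.Walk.support_append, List.nodup_append']
    refine ⟨hw.support_nodup, hq.support_nodup.tail, fun x hx hx' => ?_⟩
    have h1 := hint x (hqs x (List.mem_of_mem_tail hx')) hx
    subst h1
    have := hq.support_nodup
    rw [← q.cons_tail_support, List.nodup_cons] at this
    exact this.1 hx'
  have hcyc : (SimpleGraph.Walk.cons hry.symm (w.append q)).IsCycle := by
    rw [SimpleGraph.Walk.cons_isCycle_iff]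
    refine ⟨hpath, fun h => ?_⟩
    have := hpath.length_eq_one_of_mem_edges (by rwa [Sym2.eq_swap])
    rw [SimpleGraph.Walk.length_append] at this
    obtain ⟨k, hk⟩ := he
    obtain ⟨l, hl⟩ := hqe
    omega
  have hodd : IsOddCycle (SimpleGraph.Walk.cons hry.symm (w.append q)).toSubgraph := by
    refine ⟨y, _, hcyc, ?_, rfl⟩
    rw [SimpleGraph.Walk.length_cons, SimpleGraph.Walk.length_append]
    exact (he.add hqe).add_one
  have heq := hG.eq_of_mem hC hodd hy (by simp)
  exact hrC (by rw [heq]; simp)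

/-- A flower is lengthened by two edges: the root `r` is not adjacent to an unsaturated vertex, so
a neighbour `y` outside the flower is matched, and sliding along `y` unsaturates its partner. -/
theorem IsGrownFlower.exists_extend [Finite V] {G : SimpleGraph V} {n : Equiv.Perm V}
    {C : G.Subgraph} {r c y : V} {w : G.Walk r c} (h : IsGrownFlower n C w)
    (hF : ∀ x, x ∈ C.verts ∨ x ∈ w.support → n x ∈ C.verts ∨ n x ∈ w.support)
    (hry : G.Adj r y) (hyC : y ∉ C.verts) (hyw : y ∉ w.support) :
    ∃ (n' : Equiv.Perm V) (z : V) (w' : G.Walk z c), IsGrownFlower n' C w' ∧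
      w'.support = z :: y :: w.support ∧
      (∀ x, x ∈ C.verts ∨ x ∈ w'.support → n' x ∈ C.verts ∨ n' x ∈ w'.support) ∧
      ∀ x, ¬ (x ∈ C.verts ∨ x ∈ w'.support) → n' x = n x := by
  obtain ⟨n', hn', a1, a2, a3, a4⟩ := h.isMax.exists_slide h.root hry
  set z := n y with hz
  have hnz : n z = y := h.isMax.1.1 y
  have hzF : ¬ (z ∈ C.verts ∨ z ∈ w.support) := fun hc => by
    have := hF z hc
    rw [hnz] at this
    tauto
  have hzy : z ≠ y := fun hc => h.isMax.not_adj h.root (hz ▸ hc) hry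
  have hyz : G.Adj z y := (h.isMax.1.2 y hzy).symm
  have hrz : r ≠ z := by rintro hc; exact hzF (Or.inr (hc ▸ w.start_mem_support))
  -- The slide only affects `r`, `y` and `z`.
  have hold : ∀ x, x ∈ C.verts ∨ x ∈ w.support → x ≠ r → n' x = n x := fun x hx hxr =>
    a4 x hxr (by rintro rfl; tauto) (by rintro rfl; tauto)
  refine ⟨n', z, .cons hyz (.cons hry.symm w), ⟨hn', h.base_mem, ?_, ?_, ?_, ?_, ?_, a3, ?_⟩,
    by simp, ?_, ?_⟩
  · by_cases hcr : c = r
    · left; rw [hcr, a1]; exact hyC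
    · rw [hold c (Or.inl h.base_mem) hcr]; exact h.base
  · intro x hx hxc
    rw [hold x (Or.inl hx) fun hxr => hxc (h.inter x hx (hxr ▸ w.start_mem_support))]
    exact h.adj x hx hxc
  · simp only [SimpleGraph.Walk.cons_isPath_iff, SimpleGraph.Walk.support_cons, List.mem_cons,
      not_or]
    exact ⟨⟨h.isPath, hyw⟩, hzy, fun hc => hzF (Or.inr hc)⟩
  · simpa [parity_simps] using h.even
  · have hE : ∀ e ∈ w.edges,
        (e ∈ (matchingSubgraph G n).edgeSet ↔ e ∈ (matchingSubgraph G n').edgeSet) := by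
      have key : ∀ u v, u ∈ w.support → v ∈ w.support → u ≠ v → (n u = v ↔ n' u = v) := by
        intro u v hu hv huv
        by_cases hur : u = r
        · subst hur
          rw [h.root, a1]
          exact ⟨fun hc => absurd hc huv, fun hc => absurd (hc ▸ hv) hyw⟩
        · rw [hold u (Or.inr hu) hur]
      intro e he
      induction e using Sym2.ind with
      | _ u v =>
      have hu := w.fst_mem_support_of_mem_edges he
      have hv := w.snd_mem_support_of_mem_edges he
      have huv := (w.adj_of_mem_edges he).ne
      change (matchingSubgraph G n).Adj u v ↔ (matchingSubgraph G n').Adj u v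
      rw [h.isMax.1.matchingSubgraph_adj, hn'.1.matchingSubgraph_adj, key u v hu hv huv]
    have hw : IsAlternatingWalk (matchingSubgraph G n') w := by
      refine List.IsChain.imp_of_mem_imp ?_ h.alt
      intro e f he hf hx
      rwa [← hE e he, ← hE f hf]
    have e1 : s(z, y) ∉ (matchingSubgraph G n').edgeSet := by
      intro hc
      have := (hn'.1.matchingSubgraph_adj.1 hc).1
      rw [a3] at this
      exact hzy this
    have e2 : s(y, r) ∈ (matchingSubgraph G n').edgeSet :=
      hn'.1.matchingSubgraph_adj.2 ⟨a2, hry.ne'⟩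
    have e3 : ∀ f ∈ w.edges.head?, f ∉ (matchingSubgraph G n').edgeSet := by
      intro f hf hfm
      cases w with
      | nil => simp at hf
      | cons hadj w =>
        simp only [SimpleGraph.Walk.edges_cons, List.head?_cons, Option.mem_some_iff] at hf
        subst hf
        have := (hn'.1.matchingSubgraph_adj.1 hfm).1
        rw [a1] at this
        subst this
        simp at hyw
    unfold IsAlternatingWalk
    simp only [SimpleGraph.Walk.edges_cons, List.isChain_cons]
    refine ⟨?_, fun f hf => ?_, hw⟩
    · simp only [List.head?_cons, Option.mem_some_iff]
      rintro f rfl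
      exact Or.inr ⟨e2, e1⟩
    · exact Or.inl ⟨e2, e3 f hf⟩
  · intro x hx hxs
    simp only [SimpleGraph.Walk.support_cons, List.mem_cons] at hxs
    rcases hxs with rfl | rfl | hxs
    · exact absurd (Or.inl hx) hzF
    · exact absurd hx hyC
    · exact h.inter x hx hxs
  · intro x hx
    simp only [SimpleGraph.Walk.support_cons, List.mem_cons] at hx ⊢
    by_cases hxz : x = z
    · rw [hxz, a3]; tauto
    by_cases hxy : x = y
    · rw [hxy, a2]; right; right; right; exact w.start_mem_support
    by_cases hxr : x = r
    · rw [hxr, a1]; tauto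
    have hx' : x ∈ C.verts ∨ x ∈ w.support := by tauto
    rw [hold x hx' hxr]
    have := hF x hx'
    tauto
  · intro x hx
    simp only [SimpleGraph.Walk.support_cons, List.mem_cons, not_or] at hx
    exact a4 x (by rintro rfl; exact hx.2.2.2 w.start_mem_support) hx.2.2.1 hx.2.1

/-- From an edge `cy` of the maximum matching `m` leaving an odd cycle `C` that the maximum matching
`m'` exposes at `c`, alternately following `m` and `m'` sweeps out a flower of `C`. The walk never
returns to `C`, so it ends in a vertex unsaturated by `m`, and its vertex set is closed under both
matchings away from `C`. -/
theorem IsRDisjoint.exists_closed_flower [Finite V] {G : SimpleGraph V} (hG : IsRDisjoint G)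
    {C : G.Subgraph} (hC : IsOddCycle C) {m m' : Equiv.Perm V} (hm : IsMaxMatchingPerm G m)
    {c : V} (hm' : IsMaxMatchingPerm G m') (hexp : Exposes m' C c) :
    ∃ F : Set V, F ⊆ reach C ∧ C.verts ⊆ F ∧ m c ∈ F ∧ (∀ x ∈ F, x ∉ C.verts → m x ∈ F) ∧
      ∀ x ∈ F, m' x ∈ F := by
  by_cases hmc : m c ∈ C.verts
  · exact ⟨C.verts, hG.subset_reach hC, subset_rfl, hmc, fun x hx hx' => absurd hx hx',
      fun x => hexp.mem⟩
  by_contra hcon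
  -- Otherwise a flower on which `m` matches all stem vertices but the root can always be extended.
  have key : ∀ N : ℕ, ∃ (n : Equiv.Perm V) (r : V) (w : G.Walk r c), IsGrownFlower n C w ∧
      N ≤ w.length ∧
      (∀ x, x ∈ C.verts ∨ x ∈ w.support → n x ∈ C.verts ∨ n x ∈ w.support) ∧
      (∀ x, ¬ (x ∈ C.verts ∨ x ∈ w.support) → n x = m' x) ∧
      ∀ x ∈ w.support, x ≠ r → m x ∈ w.support ∧ m x ≠ r := by
    intro N
    induction N with
    | zero =>
      refine ⟨m', c, .nil, isGrownFlower_nil hm' hexp, le_rfl, ?_, fun _ _ => rfl, ?_⟩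
      · intro x hx
        refine Or.inl (hexp.mem ?_)
        rcases hx with hx | hx
        · exact hx
        · simp only [SimpleGraph.Walk.support_nil, List.mem_singleton] at hx
          rw [hx]; exact hexp.1
      · intro x hx hxc
        simp only [SimpleGraph.Walk.support_nil, List.mem_singleton] at hx
        exact absurd hx hxc
    | succ N ih =>
      obtain ⟨n, r, w, hw, hN, hF, hoff, hcl⟩ := ih
      have hoff' : ∀ x, ¬ (x ∈ C.verts ∨ x ∈ w.support) →
          ¬ (n x ∈ C.verts ∨ n x ∈ w.support) := fun x hx hc => hx (by
        have := hF _ hc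
        rwa [hw.isMax.1.1] at this)
      have hFm' : ∀ x, x ∈ C.verts ∨ x ∈ w.support → m' x ∈ C.verts ∨ m' x ∈ w.support := by
        intro x hx
        by_contra hc
        have h1 := hoff' _ hc
        rw [hoff _ hc, hm'.1.1] at h1
        exact h1 hx
      have hcw : c ∈ w.support := w.end_mem_support
      have hmr : m r ≠ r := by
        intro hmr
        have hcl' : ∀ x ∈ w.support, m x ∈ w.support := by
          intro x hx
          by_cases hxr : x = r
          · rw [hxr, hmr]; exact w.start_mem_support
          · exact (hcl x hx hxr).1
        exact hcon ⟨{x | x ∈ C.verts ∨ x ∈ w.support}, fun x hx => hw.mem_reach hC hx,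
          fun x hx => Or.inl hx, Or.inr (hcl' c hcw),
          fun x hx hxC => Or.inr (hcl' x (hx.resolve_left hxC)), hFm'⟩
      have hyw : m r ∉ w.support := fun hc => (hcl _ hc hmr).2 (hm.1.1 r)
      have hadj : G.Adj r (m r) := hm.1.2 r hmr
      have hyC : m r ∉ C.verts := by
        intro hc
        by_cases hcr : c = r
        · exact hmc (hcr ▸ hc)
        · refine hG.not_adj_of_path hC w hw.isPath hw.even ?_ hw.inter hw.base_mem hc ?_ hadj
          · exact SimpleGraph.Walk.not_nil_iff_lt_length.1
              (SimpleGraph.Walk.not_nil_of_ne (Ne.symm hcr))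
          · intro hcc
            exact hyw (hcc ▸ hcw)
      obtain ⟨n', z, w', hw', hsupp, hF', hoffn⟩ := hw.exists_extend hF hadj hyC hyw
      have hlen : w'.length = w.length + 2 := by
        have := congrArg List.length hsupp
        simpa using this
      have hzw : z ∉ m r :: w.support := by
        have := hw'.isPath.support_nodup
        rw [hsupp, List.nodup_cons] at this
        exact this.1
      rw [List.mem_cons, not_or] at hzw
      refine ⟨n', z, w', hw', by omega, hF', ?_, ?_⟩
      · intro x hx
        rw [hoffn x hx, hoff]
        rw [hsupp] at hx
        simp only [List.mem_cons, not_or] at hx ⊢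
        exact ⟨hx.1, hx.2.2.2⟩
      · intro x hx hxz
        rw [hsupp] at hx ⊢
        simp only [List.mem_cons] at hx ⊢
        rcases hx with rfl | rfl | hx
        · exact absurd rfl hxz
        · rw [hm.1.1]
          exact ⟨Or.inr (Or.inr w.start_mem_support),
            fun h => hzw.2 (h ▸ w.start_mem_support)⟩
        · by_cases hxr : x = r
          · rw [hxr]
            exact ⟨by tauto, Ne.symm hzw.1⟩
          · have := hcl x hx hxr
            exact ⟨by tauto, fun h => hzw.2 (h ▸ this.1)⟩
  have := Fintype.ofFinite V
  obtain ⟨n, r, w, hw, hN, -⟩ := key (Fintype.card V)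
  exact absurd hw.isPath.length_lt (by omega)

/-- A further odd cycle can be exposed without changing the matching on the other odd cycles. -/
theorem IsRDisjoint.exists_expose [Finite V] {G : SimpleGraph V} (hG : IsRDisjoint G)
    {C : G.Subgraph} (hC : IsOddCycle C) {m : Equiv.Perm V} (hm : IsMaxMatchingPerm G m)
    {b : V} (hb : b ∈ C.verts) :
    ∃ n, IsMaxMatchingPerm G n ∧ Exposes n C b ∧
      ∀ C' : G.Subgraph, IsOddCycle C' → C' ≠ C → ∀ x ∈ C'.verts, n x = m x := by
  obtain ⟨k, b', hk, hkb'⟩ := exists_exposes_of_reach_nonempty (hG.2.1 C hC)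
  obtain ⟨m', hm', hmb, -⟩ := hk.exists_rebase hC hkb' hb
  have hF : ∀ c : C.verts, ∃ F : Set V, F ⊆ reach C ∧ C.verts ⊆ F ∧ m c ∈ F ∧
      (∀ x ∈ F, x ∉ C.verts → m x ∈ F) ∧ ∀ x ∈ F, m' x ∈ F := by
    rintro ⟨c, hc⟩
    obtain ⟨l, hl, hlc, hoff⟩ := hm'.exists_rebase hC hmb hc
    obtain ⟨F, h1, h2, h3, h4, h5⟩ := hG.exists_closed_flower hC hm hl hlc
    refine ⟨F, h1, h2, h3, h4, fun x hx => ?_⟩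
    by_cases hxC : x ∈ C.verts
    · exact h2 (hmb.mem hxC)
    · rw [← hoff x hxC]; exact h5 x hx
  choose F h1 h2 h3 h4 h5 using hF
  let O : Set V := ⋃ c, F c
  have hCO : C.verts ⊆ O := fun x hx => Set.mem_iUnion.2 ⟨⟨x, hx⟩, h2 _ hx⟩
  have hO : ∀ x ∈ O, m x ∈ O := by
    intro x hx
    by_cases hxC : x ∈ C.verts
    · exact Set.mem_iUnion.2 ⟨⟨x, hxC⟩, h3 ⟨x, hxC⟩⟩
    · obtain ⟨c, hc⟩ := Set.mem_iUnion.1 hx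
      exact Set.mem_iUnion.2 ⟨c, h4 c x hc hxC⟩
  have hO' : ∀ x ∈ O, m' x ∈ O := by
    intro x hx
    obtain ⟨c, hc⟩ := Set.mem_iUnion.1 hx
    exact Set.mem_iUnion.2 ⟨c, h5 c x hc⟩
  obtain ⟨n, hn, n1, n2⟩ := hm.exists_piecewise hm' hO hO'
  refine ⟨n, hn, ⟨hb, by rw [n1 b (hCO hb), hmb.2.1], fun x hx hxb => ?_⟩,
    fun C' hC' hne x hx => n2 x fun hxO => ?_⟩
  · rw [n1 x (hCO hx)]; exact hmb.2.2 x hx hxb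
  · obtain ⟨c, hc⟩ := Set.mem_iUnion.1 hxO
    exact hne (hG.eq_of_mem_reach hC' hC (hG.subset_reach hC' hx) (h1 c hc))

/-- Some maximum matching exposes all odd cycles at once, at prescribed bases. -/
theorem IsRDisjoint.exists_exposes_all [Finite V] {G : SimpleGraph V} (hG : IsRDisjoint G)
    (β : G.Subgraph → V) (hβ : ∀ C, IsOddCycle C → β C ∈ C.verts) :
    ∃ m, IsMaxMatchingPerm G m ∧ ∀ C, IsOddCycle C → Exposes m C (β C) := by
  classical
  have key : ∀ S : Finset G.Subgraph, ∃ m, IsMaxMatchingPerm G m ∧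
      ∀ C ∈ S, IsOddCycle C → Exposes m C (β C) := by
    intro S
    induction S using Finset.induction_on with
    | empty =>
      obtain ⟨m, hm⟩ := exists_isMaxMatchingPerm G
      exact ⟨m, hm, by simp⟩
    | insert C S _ ih =>
      obtain ⟨m, hm, h⟩ := ih
      by_cases hC : IsOddCycle C
      · obtain ⟨n, hn, hnC, hoff⟩ := hG.exists_expose hC hm (hβ C hC)
        refine ⟨n, hn, fun C' hC'S hC' => ?_⟩
        by_cases hne : C' = C
        · rw [hne]; exact hnC
        · have hm' := h C' ((Finset.mem_insert.1 hC'S).resolve_left hne) hC'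
          refine ⟨hm'.1, by rw [hoff C' hC' hne _ hm'.1, hm'.2.1], fun x hx hxb => ?_⟩
          rw [hoff C' hC' hne x hx]
          exact hm'.2.2 x hx hxb
      · refine ⟨m, hm, fun C' hC'S hC' => h C' ((Finset.mem_insert.1 hC'S).resolve_left ?_) hC'⟩
        rintro rfl
        exact hC hC'
  have := Fintype.ofFinite G.Subgraph
  obtain ⟨m, hm, h⟩ := key Finset.univ
  exact ⟨m, hm, fun C hC => h C (Finset.mem_univ _) hC⟩

/-! ### Vertices on odd cycles -/

/-- The set of vertices that lie on some odd cycle. -/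
def oddVerts (G : SimpleGraph V) : Set V := {x | ∃ C : G.Subgraph, IsOddCycle C ∧ x ∈ C.verts}

/-- The matching `m` exposes every odd cycle `C`, at the base `β C`. -/
def ExposesAll (G : SimpleGraph V) (m : Equiv.Perm V) (β : G.Subgraph → V) : Prop :=
  ∀ C : G.Subgraph, IsOddCycle C → Exposes m C (β C)

theorem ExposesAll.mem_oddVerts {G : SimpleGraph V} {m : Equiv.Perm V} {β : G.Subgraph → V}
    (h : ExposesAll G m β) {x : V} (hx : x ∈ oddVerts G) : m x ∈ oddVerts G := by
  obtain ⟨C, hC, hxC⟩ := hx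
  exact ⟨C, hC, (h C hC).mem hxC⟩

theorem ExposesAll.notMem_oddVerts {G : SimpleGraph V} {m : Equiv.Perm V} {β : G.Subgraph → V}
    (h : ExposesAll G m β) (hm : IsMatchingPerm G m) {x : V} (hx : x ∉ oddVerts G) :
    m x ∉ oddVerts G := fun hc => hx (by simpa [hm.1] using h.mem_oddVerts hc)

theorem ExposesAll.fixedSet_inter {G : SimpleGraph V} {m : Equiv.Perm V} {β : G.Subgraph → V}
    (h : ExposesAll G m β) :
    fixedSet m ∩ oddVerts G = β '' {C : G.Subgraph | IsOddCycle C} := by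
  ext x
  constructor
  · rintro ⟨hx, C, hC, hxC⟩
    exact ⟨C, hC, ((h C hC).eq_base hxC hx).symm⟩
  · rintro ⟨C, hC, rfl⟩
    exact ⟨(h C hC).2.1, C, hC, (h C hC).1⟩

theorem IsRDisjoint.ncard_bases [Finite V] {G : SimpleGraph V} (hG : IsRDisjoint G)
    {m : Equiv.Perm V} {β : G.Subgraph → V} (h : ExposesAll G m β) :
    (fixedSet m ∩ oddVerts G).ncard = {C : G.Subgraph | IsOddCycle C}.ncard := by
  rw [h.fixedSet_inter]
  refine Set.InjOn.ncard_image fun C hC C' hC' heq => ?_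
  exact hG.eq_of_mem hC hC' (h C hC).1 (heq ▸ (h C' hC').1)

theorem IsRDisjoint.exists_exposesAll [Finite V] {G : SimpleGraph V} (hG : IsRDisjoint G)
    {P : G.Subgraph → V → Prop} (hP : ∀ C, IsOddCycle C → ∃ c ∈ C.verts, P C c) :
    ∃ m β, IsMaxMatchingPerm G m ∧ ExposesAll G m β ∧ ∀ C, IsOddCycle C → P C (β C) := by
  obtain ⟨C, hC⟩ := hG.1
  have : Nonempty V := hC.verts_nonempty.to_type
  choose! β hβ hβ' using hP
  obtain ⟨m, hm, h⟩ := hG.exists_exposes_all β hβ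
  exact ⟨m, β, hm, h, hβ'⟩

theorem IsMaxMatchingPerm.ncard_fixedSet_eq [Finite V] {G : SimpleGraph V} {m m' : Equiv.Perm V}
    (hm : IsMaxMatchingPerm G m) (hm' : IsMaxMatchingPerm G m') :
    (fixedSet m).ncard = (fixedSet m').ncard :=
  le_antisymm (hm.2 _ hm'.1) (hm'.2 _ hm.1)

/-- The number of vertices off the odd cycles that are left unsaturated does not depend on the
choice of the maximum matching that exposes all odd cycles. -/
theorem IsRDisjoint.ncard_fixedSet_diff_eq [Finite V] {G : SimpleGraph V} (hG : IsRDisjoint G)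
    {m m' : Equiv.Perm V} {β β' : G.Subgraph → V} (hm : IsMaxMatchingPerm G m)
    (hm' : IsMaxMatchingPerm G m') (h : ExposesAll G m β) (h' : ExposesAll G m' β') :
    (fixedSet m \ oddVerts G).ncard = (fixedSet m' \ oddVerts G).ncard := by
  have h1 := hm.ncard_fixedSet_eq hm'
  have h2 := Set.ncard_inter_add_ncard_sdiff_eq_ncard (fixedSet m) (oddVerts G)
  have h3 := Set.ncard_inter_add_ncard_sdiff_eq_ncard (fixedSet m') (oddVerts G)
  rw [hG.ncard_bases h] at h2
  rw [hG.ncard_bases h'] at h3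
  omega

/-! ### A set of large difference -/

theorem mem_nbhd {G : SimpleGraph V} {X : Finset V} {v : V} :
    v ∈ nbhd G X ↔ ∃ u ∈ X, G.Adj u v := Iff.rfl

theorem nbhd_mono {G : SimpleGraph V} {X Y : Finset V} (h : X ⊆ Y) : nbhd G X ⊆ nbhd G Y :=
  fun _ ⟨u, hu, huv⟩ => ⟨u, h hu, huv⟩

/-- For a colour class `L` of the bipartite graph off the odd cycles, Hall's theorem provides a
subset of `L` whose difference is at least the number of unsaturated vertices of `L`; otherwise there would
be a larger matching. Each odd cycle counts as a single target, since by rotating its base it can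
absorb one edge at any of its vertices, but only one. -/
theorem IsRDisjoint.exists_le_diff_of_color [Finite V] {G : SimpleGraph V} (hG : IsRDisjoint G)
    {m : Equiv.Perm V} {β : G.Subgraph → V} (hm : IsMaxMatchingPerm G m) (h : ExposesAll G m β)
    {κ : V → Bool} (hκ : ∀ u v, u ∉ oddVerts G → v ∉ oddVerts G → G.Adj u v → κ u ≠ κ v)
    (ρ : Bool) : ∃ X : Finset V, (∀ x ∈ X, x ∉ oddVerts G ∧ κ x = ρ) ∧
      {v | (v ∉ oddVerts G ∧ κ v = ρ) ∧ m v = v}.ncard + (nbhd G X).ncard ≤ X.card := by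
  classical
  set L : Set V := {v | v ∉ oddVerts G ∧ κ v = ρ} with hL
  set E : Set V := {v | v ∈ L ∧ m v = v} with hE
  change ∃ X : Finset V, (∀ x ∈ X, x ∈ L) ∧ E.ncard + (nbhd G X).ncard ≤ X.card
  by_contra hcon
  push Not at hcon
  obtain ⟨d, hd⟩ : ∃ d, E.ncard = d + 1 := by
    have := hcon ∅ (by simp)
    exact Nat.exists_eq_succ_of_ne_zero fun h0 => by
      have e : nbhd G ∅ = ∅ := by ext; simp [nbhd]
      rw [e, h0] at this
      simp at this
  have : Fintype L := Fintype.ofFinite _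
  have : Fintype V := Fintype.ofFinite _
  -- `π` contracts each odd cycle to its base.
  obtain ⟨π, hπ1, hπ2⟩ : ∃ π : V → V, (∀ v ∉ oddVerts G, π v = v) ∧
      ∀ C, IsOddCycle C → ∀ v ∈ C.verts, π v = β C := by
    refine ⟨fun v => if hv : ∃ C, IsOddCycle C ∧ v ∈ C.verts then β hv.choose else v,
      fun v hv => dif_neg hv,
      fun C hC v hv => ?_⟩
    have hv' : ∃ C, IsOddCycle C ∧ v ∈ C.verts := ⟨C, hC, hv⟩
    have hs := hv'.choose_spec
    exact (dif_pos hv').trans (congrArg β (hG.eq_of_mem hs.1 hC hs.2 hv))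
  have hπU : ∀ v ∈ oddVerts G, π v ∈ oddVerts G := by
    rintro v ⟨C, hC, hv⟩
    rw [hπ2 C hC v hv]
    exact ⟨C, hC, (h C hC).1⟩
  have hall : ∀ X : Finset V, (∀ x ∈ X, x ∈ L) → X.card ≤ (π '' nbhd G X).ncard + d := by
    intro X hX
    by_cases hXU : ∃ y ∈ nbhd G X, y ∈ oddVerts G
    · obtain ⟨y, hy, hyU⟩ := hXU
      have h1 : (insert (π y) (nbhd G X \ oddVerts G)).ncard ≤ (π '' nbhd G X).ncard := by
        refine Set.ncard_le_ncard ?_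
        rintro z (rfl | ⟨hz, hzU⟩)
        · exact ⟨y, hy, rfl⟩
        · exact ⟨z, hz, hπ1 z hzU⟩
      rw [Set.ncard_insert_of_notMem fun hc => hc.2 (hπU y hyU)] at h1
      have h2 : ((X : Set V) \ E).ncard ≤ (nbhd G X \ oddVerts G).ncard := by
        refine Set.ncard_le_ncard_of_injOn m ?_ m.injective.injOn
        rintro x ⟨hx, hxE⟩
        have hne : m x ≠ x := fun hc => hxE ⟨hX x hx, hc⟩
        exact ⟨⟨x, hx, hm.1.2 x hne⟩, h.notMem_oddVerts hm.1 (hX x hx).1⟩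
      have h3 := Set.ncard_inter_add_ncard_sdiff_eq_ncard (X : Set V) E
      have h4 : ((X : Set V) ∩ E).ncard ≤ E.ncard := Set.ncard_le_ncard Set.inter_subset_right
      rw [Set.ncard_coe_finset] at h3
      omega
    · push Not at hXU
      have e : π '' nbhd G X = nbhd G X := by
        ext z
        constructor
        · rintro ⟨y, hy, rfl⟩
          rwa [hπ1 y (hXU y hy)]
        · intro hz
          exact ⟨z, hz, hπ1 z (hXU z hz)⟩
      have := hcon X hX
      rw [e]
      omega
  -- The `d` dummy targets absorb a deficiency that is one short of `|E|`.
  let t : L → Finset (V ⊕ Fin d) := fun x =>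
    Finset.univ.filter fun s => (∃ y, G.Adj x y ∧ s = Sum.inl (π y)) ∨ ∃ i, s = Sum.inr i
  have ht : ∀ x s, s ∈ t x ↔ (∃ y, G.Adj x y ∧ s = Sum.inl (π y)) ∨ ∃ i, s = Sum.inr i := by
    intro x s; simp [t]
  obtain ⟨f, hf, hft⟩ := (Finset.all_card_le_biUnion_card_iff_exists_injective t).1 (by
    intro s
    rcases s.eq_empty_or_nonempty with rfl | ⟨x0, hx0⟩
    · simp
    have h1 := hall (s.map (Function.Embedding.subtype _)) (by
      intro x hx
      obtain ⟨y, -, rfl⟩ := Finset.mem_map.1 hx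
      exact y.2)
    rw [Finset.card_map] at h1
    refine h1.trans ?_
    have h2 : (s.biUnion t : Set (V ⊕ Fin d)) = Sum.inl ''
        (π '' nbhd G (s.map (Function.Embedding.subtype _))) ∪ Set.range Sum.inr := by
      ext z
      simp only [Finset.coe_biUnion, Set.mem_iUnion, Finset.mem_coe, ht, Set.mem_union,
        Set.mem_image, Set.mem_range]
      constructor
      · rintro ⟨x, hx, ⟨y, hy, rfl⟩ | ⟨i, rfl⟩⟩
        · exact Or.inl ⟨π y, ⟨y, ⟨x, Finset.mem_map.2 ⟨x, hx, rfl⟩, hy⟩, rfl⟩, rfl⟩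
        · exact Or.inr ⟨i, rfl⟩
      · rintro (⟨-, ⟨y, ⟨x, hx, hy⟩, rfl⟩, rfl⟩ | ⟨i, rfl⟩)
        · obtain ⟨x', hx', rfl⟩ := Finset.mem_map.1 hx
          exact ⟨x', hx', Or.inl ⟨y, hy, rfl⟩⟩
        · exact ⟨x0, hx0, Or.inr ⟨i, rfl⟩⟩
    rw [← Set.ncard_coe_finset, h2, Set.ncard_union_eq,
      Set.ncard_image_of_injective _ Sum.inl_injective, ← Set.image_univ,
      Set.ncard_image_of_injective _ Sum.inr_injective]
    · simp
    · rw [Set.disjoint_left]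
      rintro _ ⟨z, -, rfl⟩ ⟨i, hi⟩
      cases hi)
  -- `A` consists of the vertices of `L` that are not sent to one of the `d` dummy targets.
  let A : Finset V := Finset.univ.filter fun x => ∃ hx : x ∈ L, ∃ v, f ⟨x, hx⟩ = Sum.inl v
  have hAL : ∀ a ∈ A, a ∈ L := fun a ha => (Finset.mem_filter.1 ha).2.1
  have hAcard : L.ncard ≤ A.card + d := by
    have h1 : (L \ A).ncard ≤ d := by
      have : ∀ x : ↥(L \ (A : Set V)), ∃ i : Fin d, f ⟨x.1, x.2.1⟩ = Sum.inr i := by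
        rintro ⟨x, hx, hxA⟩
        rcases hfx : f ⟨x, hx⟩ with v | i
        · exact absurd (Finset.mem_coe.2 (Finset.mem_filter.2 ⟨Finset.mem_univ _, hx, v, hfx⟩)) hxA
        · exact ⟨i, rfl⟩
      choose i hi using this
      have hinj : Function.Injective i := by
        intro x y hxy
        have := hf ((hi x).trans ((congrArg Sum.inr hxy).trans (hi y).symm))
        exact Subtype.ext (congrArg (fun z : L => z.1) this)
      simpa [Nat.card_coe_set_eq] using Nat.card_le_card_of_injective i hinj
    have h2 := Set.ncard_inter_add_ncard_sdiff_eq_ncard L (A : Set V)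
    have h3 : (L ∩ (A : Set V)).ncard ≤ A.card := by
      rw [← Set.ncard_coe_finset]
      exact Set.ncard_le_ncard Set.inter_subset_right
    omega
  have hg : ∀ a : V, ∃ y, ∀ ha : a ∈ A, G.Adj a y ∧ f ⟨a, hAL a ha⟩ = Sum.inl (π y) := by
    intro a
    by_cases ha : a ∈ A
    · obtain ⟨hx, v, hv⟩ := (Finset.mem_filter.1 ha).2
      rcases (ht ⟨a, hx⟩ _).1 (hft ⟨a, hx⟩) with ⟨y, hy, hfy⟩ | ⟨i, hi⟩
      · exact ⟨y, fun _ => ⟨hy, hfy⟩⟩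
      · rw [hv] at hi; cases hi
    · exact ⟨a, fun h => absurd h ha⟩
  choose g hg using hg
  have hginj : ∀ a ∈ A, ∀ a' ∈ A, π (g a) = π (g a') → a = a' := by
    intro a ha a' ha' heq
    have h1 := (hg a ha).2
    have h2 := (hg a' ha').2
    rw [heq, ← h2] at h1
    exact congrArg Subtype.val (hf h1)
  obtain ⟨m1, β1, hm1, h1, hβ1⟩ := hG.exists_exposesAll
    (P := fun C c => ∀ a ∈ A, g a ∈ C.verts → g a = c) (by
      intro C hC
      by_cases hA : ∃ a ∈ A, g a ∈ C.verts
      · obtain ⟨a, ha, hga⟩ := hA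
        refine ⟨g a, hga, fun a' ha' hga' => ?_⟩
        rw [hginj a' ha' a ha (by rw [hπ2 C hC _ hga, hπ2 C hC _ hga'])]
      · push Not at hA
        obtain ⟨c, hc⟩ := hC.verts_nonempty
        exact ⟨c, hc, fun a ha hga => absurd hga (hA a ha)⟩)
  obtain ⟨n0, hn0, k1, k2⟩ := IsMatchingPerm.exists_piecewise (G := G) (m := 1) (m' := m1)
    (by simp [IsMatchingPerm]) hm1.1 (O := oddVerts G) (by simp) (fun x => h1.mem_oddVerts)
  obtain ⟨n', hn', hcard⟩ := hn0.exists_add_edges A g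
    (fun a ha a' ha' heq => hginj a ha a' ha' (by rw [heq])) (by
      intro a ha
      refine ⟨by rw [k2 a (hAL a ha).1]; rfl, ?_, (hg a ha).1, fun hga => ?_⟩
      · by_cases hU : g a ∈ oddVerts G
        · rw [k1 _ hU]
          obtain ⟨C, hC, hgC⟩ := hU
          rw [hβ1 C hC a ha hgC, (h1 C hC).2.1]
        · rw [k2 _ hU]; rfl
      · exact hκ a (g a) (hAL a ha).1 (hAL _ hga).1 (hg a ha).1
          ((hAL a ha).2.trans (hAL _ hga).2.symm))
  have c1 := ncard_fixedSet_piecewise k1 k2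
  have c2 : fixedSet (1 : Equiv.Perm V) \ oddVerts G = (oddVerts G)ᶜ := by
    ext x; simp [mem_fixedSet]
  rw [hG.ncard_bases h1, c2] at c1
  have c3 := Set.ncard_inter_add_ncard_sdiff_eq_ncard (fixedSet m) (oddVerts G)
  rw [hG.ncard_bases h] at c3
  have c4 := hm.2 n' hn'
  have c5 := Set.ncard_inter_add_ncard_sdiff_eq_ncard L E
  have c6 : L ∩ E = E := Set.inter_eq_right.2 fun x hx => hx.1
  rw [c6] at c5
  have c7 : (oddVerts G)ᶜ.ncard ≤ (fixedSet m \ oddVerts G).ncard + 2 * (L \ E).ncard := by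
    have hsub : (oddVerts G)ᶜ ⊆ (fixedSet m \ oddVerts G) ∪ ((L \ E) ∪ m '' (L \ E)) := by
      intro x hx
      by_cases hfx : m x = x
      · exact Or.inl ⟨hfx, hx⟩
      right
      have hmx := h.notMem_oddVerts hm.1 hx
      by_cases hc : κ x = ρ
      · exact Or.inl ⟨⟨hx, hc⟩, fun hE => hfx hE.2⟩
      · have hne := hκ x (m x) hx hmx (hm.1.2 x hfx)
        refine Or.inr ⟨m x, ⟨⟨hmx, ?_⟩, fun hE => hfx ?_⟩, hm.1.1 x⟩
        · revert hc hne
          cases κ x <;> cases κ (m x) <;> cases ρ <;> simp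
        · have := hE.2
          rw [hm.1.1] at this
          exact this.symm
    have a1 := Set.ncard_le_ncard hsub
    have a2 := Set.ncard_union_le (fixedSet m \ oddVerts G) ((L \ E) ∪ m '' (L \ E))
    have a3 := Set.ncard_union_le (L \ E) (m '' (L \ E))
    rw [Set.ncard_image_of_injective _ m.injective] at a3
    omega
  omega

/-- Some independent set has difference at least the number of vertices off the odd cycles that are
left unsaturated by a maximum matching exposing all odd cycles. -/
theorem IsRDisjoint.exists_isIndepSet_le_diff [Finite V] {G : SimpleGraph V} (hG : IsRDisjoint G)
    {m : Equiv.Perm V} {β : G.Subgraph → V} (hm : IsMaxMatchingPerm G m) (h : ExposesAll G m β) :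
    ∃ X : Finset V, G.IsIndepSet (X : Set V) ∧
      ((fixedSet m \ oddVerts G).ncard : ℤ) ≤ diff G X := by
  classical
  obtain ⟨κ, hκ⟩ := exists_coloring_off (G := G) (T := oddVerts G) (by
    intro C hC
    obtain ⟨x, hx⟩ := hC.verts_nonempty
    exact ⟨x, hx, C, hC, hx⟩)
  obtain ⟨X, hX, hX'⟩ := hG.exists_le_diff_of_color hm h hκ true
  obtain ⟨Y, hY, hY'⟩ := hG.exists_le_diff_of_color hm h hκ false
  have hdisj : Disjoint X Y := by
    rw [Finset.disjoint_left]
    intro x hx hy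
    have h1 := (hX x hx).2
    rw [(hY x hy).2] at h1
    cases h1
  have hn : nbhd G (X ∪ Y) = nbhd G X ∪ nbhd G Y := by
    ext v
    simp only [mem_nbhd, Finset.mem_union, Set.mem_union]
    constructor
    · rintro ⟨u, hu | hu, huv⟩
      · exact Or.inl ⟨u, hu, huv⟩
      · exact Or.inr ⟨u, hu, huv⟩
    · rintro (⟨u, hu, huv⟩ | ⟨u, hu, huv⟩)
      · exact ⟨u, Or.inl hu, huv⟩
      · exact ⟨u, Or.inr hu, huv⟩
  have hE : (fixedSet m \ oddVerts G).ncard ≤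
      {v | (v ∉ oddVerts G ∧ κ v = true) ∧ m v = v}.ncard +
      {v | (v ∉ oddVerts G ∧ κ v = false) ∧ m v = v}.ncard := by
    refine le_trans (Set.ncard_le_ncard ?_) (Set.ncard_union_le _ _)
    rintro x ⟨hx, hxU⟩
    rcases hc : κ x
    · exact Or.inr ⟨⟨hxU, hc⟩, hx⟩
    · exact Or.inl ⟨⟨hxU, hc⟩, hx⟩
  set Z := X ∪ Y with hZ
  have hZc : Z.card = X.card + Y.card := Finset.card_union_of_disjoint hdisj
  have hZn := Set.ncard_union_le (nbhd G X) (nbhd G Y)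
  rw [← hn] at hZn
  -- Removing the vertices with a neighbour in `Z` makes `Z` independent.
  let W : Finset V := Z.filter fun x => x ∉ nbhd G Z
  have hWZ : W ⊆ Z := Finset.filter_subset _ _
  refine ⟨W, ?_, ?_⟩
  · intro x hx y hy _ hxy
    exact (Finset.mem_filter.1 hy).2 ⟨x, hWZ hx, hxy⟩
  · have h1 : (nbhd G W).ncard + (Z.filter fun x => x ∈ nbhd G Z).card ≤ (nbhd G Z).ncard := by
      rw [← Set.ncard_coe_finset, ← Set.ncard_union_eq]
      · refine Set.ncard_le_ncard ?_
        rintro v (hv | hv)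
        · exact nbhd_mono hWZ hv
        · exact (Finset.mem_filter.1 hv).2
      · rw [Set.disjoint_left]
        rintro v ⟨u, hu, huv⟩ hv
        exact (Finset.mem_filter.1 hu).2 ⟨v, (Finset.mem_filter.1 hv).1, huv.symm⟩
    have h2 := Finset.card_filter_add_card_filter_not (s := Z) fun x => x ∈ nbhd G Z
    have h3 : (Z.filter fun x => ¬ x ∈ nbhd G Z).card = W.card := rfl
    unfold diff
    omega

/-! ### The kernel and the core -/

theorem mem_ker {G : SimpleGraph V} {x : V} :
    x ∈ ker G ↔ ∀ S : Finset V, IsCriticalIndepSet G S → x ∈ S := by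
  simp [ker]

theorem mem_core [Finite V] {G : SimpleGraph V} {x : V} :
    x ∈ core G ↔ ∀ S : Finset V, G.IsMaximumIndepSet S → x ∈ S := by
  simp [core]

theorem exists_isCriticalIndepSet [Finite V] (G : SimpleGraph V) :
    ∃ K : Finset V, IsCriticalIndepSet G K := by
  have hne : {X : Finset V | G.IsIndepSet (X : Set V)}.Nonempty :=
    ⟨∅, by simp [SimpleGraph.IsIndepSet]⟩
  have := Fintype.ofFinite V
  obtain ⟨K, hK, h⟩ := Set.exists_max_image _ (fun X => diff G X) (Set.toFinite _) hne
  exact ⟨K, hK, h⟩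

theorem notMem_nbhd_of_isIndepSet {G : SimpleGraph V} {K : Finset V}
    (hK : G.IsIndepSet (K : Set V)) {x : V} (hx : x ∈ K) : x ∉ nbhd G K := by
  rintro ⟨u, hu, hux⟩
  exact hK hu hx hux.ne hux

/-- A critical independent set meets every maximum independent set in a critical independent set. -/
theorem IsCriticalIndepSet.inter [Finite V] [DecidableEq V] {G : SimpleGraph V} {K S : Finset V}
    (hK : IsCriticalIndepSet G K) (hS : G.IsMaximumIndepSet S) :
    IsCriticalIndepSet G (K ∩ S) := by
  classical
  have hSi : G.IsIndepSet (S : Set V) := hS.isIndepSet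
  refine ⟨fun x hx y hy => hSi (by simp at hx; exact hx.2) (by simp at hy; exact hy.2),
    fun X hX => (hK.2 X hX).trans ?_⟩
  let S' := (S.filter fun x => x ∉ nbhd G K) ∪ K
  have hS' : G.IsIndepSet (S' : Set V) := by
    have key : ∀ x ∈ S', ∀ y ∈ K, ¬ G.Adj x y := by
      intro x hx y hy hxy
      rcases Finset.mem_union.1 hx with hx | hx
      · exact (Finset.mem_filter.1 hx).2 ⟨y, hy, hxy.symm⟩
      · exact hK.1 hx hy hxy.ne hxy
    intro x hx y hy hne hxy
    rcases Finset.mem_union.1 hx with hx' | hx'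
    · rcases Finset.mem_union.1 hy with hy' | hy'
      · exact hSi (Finset.mem_filter.1 hx').1 (Finset.mem_filter.1 hy').1 hne hxy
      · exact key x hx y hy' hxy
    · exact key y hy x hx' hxy.symm
  have h1 := hS.maximum S' hS'
  have h2 : S'.card = (S.filter fun x => x ∉ nbhd G K).card + (K \ S).card := by
    rw [← Finset.card_union_of_disjoint]
    · congr 1
      ext x
      simp only [S', Finset.mem_union, Finset.mem_filter, Finset.mem_sdiff]
      have := fun hx : x ∈ K => notMem_nbhd_of_isIndepSet hK.1 hx
      tauto
    · rw [Finset.disjoint_left]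
      intro x hx hx'
      exact (Finset.mem_sdiff.1 hx').2 (Finset.mem_filter.1 hx).1
  have h3 := Finset.card_filter_add_card_filter_not (s := S) fun x => x ∈ nbhd G K
  have h4 : (nbhd G (K ∩ S)).ncard + (S.filter fun x => x ∈ nbhd G K).card ≤
      (nbhd G K).ncard := by
    rw [← Set.ncard_coe_finset, ← Set.ncard_union_eq]
    · refine Set.ncard_le_ncard ?_
      rintro v (hv | hv)
      · exact nbhd_mono Finset.inter_subset_left hv
      · exact (Finset.mem_filter.1 hv).2
    · rw [Set.disjoint_left]
      rintro v ⟨u, hu, huv⟩ hv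
      exact hSi (Finset.mem_inter.1 hu).2 (Finset.mem_filter.1 hv).1 huv.ne huv
  have h5 := Finset.card_inter_add_card_sdiff K S
  unfold diff
  omega

theorem ker_subset_core [Finite V] (G : SimpleGraph V) : ker G ⊆ core G := by
  classical
  intro x hx
  rw [mem_core]
  intro S hS
  obtain ⟨K, hK⟩ := exists_isCriticalIndepSet G
  exact (Finset.mem_inter.1 (mem_ker.1 hx _ (hK.inter hS))).2

/-- An independent set misses a vertex of each odd cycle. With these vertices as bases, it contains no
unsaturated vertex of an odd cycle. -/
theorem IsRDisjoint.exists_exposesAll_of_isIndepSet [Finite V] {G : SimpleGraph V}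
    (hG : IsRDisjoint G) {J : Finset V} (hJ : G.IsIndepSet (J : Set V)) :
    ∃ m β, IsMaxMatchingPerm G m ∧ ExposesAll G m β ∧
      ∀ x ∈ (J : Set V) \ (fixedSet m \ oddVerts G), m x ≠ x := by
  obtain ⟨m, β, hm, h, hβ⟩ := hG.exists_exposesAll (P := fun _ c => c ∉ J) (by
    intro C hC
    obtain ⟨x, hx⟩ := hC.verts_nonempty
    obtain ⟨y, hy⟩ := hC.exists_adj hx
    by_cases hxJ : x ∈ J
    · exact ⟨y, hy.snd_mem, fun hyJ => hJ hxJ hyJ hy.ne hy.adj_sub⟩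
    · exact ⟨x, hx, hxJ⟩)
  refine ⟨m, β, hm, h, ?_⟩
  rintro x ⟨hx, hxE⟩ hfix
  by_cases hU : x ∈ oddVerts G
  · obtain ⟨C, hC, hxC⟩ := hU
    have := hβ C hC
    rw [← (h C hC).eq_base hxC hfix] at this
    exact this hx
  · exact hxE ⟨hfix, hU⟩

/-- For a critical independent set `K` of an `R`-disjoint graph, a suitable maximum matching exposes
all odd cycles, leaves no vertex outside `K` unsaturated but the bases, and matches the saturated
vertices of `K` with the whole neighbourhood of `K`. -/
theorem IsRDisjoint.exists_matching_of_isCritical [Finite V] {G : SimpleGraph V}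
    (hG : IsRDisjoint G) {K : Finset V} (hK : IsCriticalIndepSet G K) :
    ∃ m β, IsMaxMatchingPerm G m ∧ ExposesAll G m β ∧ fixedSet m \ oddVerts G ⊆ K ∧
      m '' ((K : Set V) \ (fixedSet m \ oddVerts G)) = nbhd G K := by
  obtain ⟨m, β, hm, h, hne⟩ := hG.exists_exposesAll_of_isIndepSet hK.1
  obtain ⟨X, hX, hXd⟩ := hG.exists_isIndepSet_le_diff hm h
  have hd := hXd.trans (hK.2 X hX)
  set E : Set V := fixedSet m \ oddVerts G with hE
  have hmaps : ∀ x ∈ (K : Set V) \ E, m x ∈ nbhd G K := fun x hx =>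
    ⟨x, hx.1, hm.1.2 x (hne x hx)⟩
  have c1 := Set.ncard_le_ncard_of_injOn m hmaps m.injective.injOn
  have c2 := Set.ncard_inter_add_ncard_sdiff_eq_ncard (K : Set V) E
  rw [Set.ncard_coe_finset] at c2
  have c4 : ((K : Set V) ∩ E).ncard ≤ E.ncard := Set.ncard_le_ncard Set.inter_subset_right
  unfold diff at hd
  -- Both inequalities are tight, because the difference of `K` is at least the size of `E`.
  have c5 : (K : Set V) ∩ E = E :=
    Set.eq_of_subset_of_ncard_le Set.inter_subset_right (by omega)
  refine ⟨m, β, hm, h, Set.inter_eq_right.1 c5, Set.eq_of_subset_of_ncard_le ?_ ?_⟩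
  · rintro _ ⟨x, hx, rfl⟩
    exact hmaps x hx
  · rw [Set.ncard_image_of_injective _ m.injective]
    change (nbhd G K).ncard ≤ ((K : Set V) \ E).ncard
    omega

/-- An independent set has at most one vertex of each matching edge, and none of the bases if these
are chosen outside it. -/
theorem IsRDisjoint.two_mul_card_le [Finite V] {G : SimpleGraph V} (hG : IsRDisjoint G)
    {m : Equiv.Perm V} {β : G.Subgraph → V} (hm : IsMaxMatchingPerm G m) (h : ExposesAll G m β)
    {J : Finset V} (hJ : G.IsIndepSet (J : Set V)) :
    2 * J.card ≤ 2 * (fixedSet m \ oddVerts G).ncard + (fixedSet m)ᶜ.ncard := by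
  obtain ⟨m', β', hm', h', hne⟩ := hG.exists_exposesAll_of_isIndepSet hJ
  have e1 := hG.ncard_fixedSet_diff_eq hm hm' h h'
  have e2 := hm.ncard_fixedSet_eq hm'
  have e3 := Set.ncard_add_ncard_compl (fixedSet m)
  have e4 := Set.ncard_add_ncard_compl (fixedSet m')
  set E := fixedSet m' \ oddVerts G with hE
  have c1 : ((J : Set V) \ E).ncard + (m' '' ((J : Set V) \ E)).ncard ≤ (fixedSet m')ᶜ.ncard := by
    rw [← Set.ncard_union_eq]
    · refine Set.ncard_le_ncard ?_
      rintro x (hx | ⟨x, hx, rfl⟩) hfix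
      · exact hne x hx hfix
      · rw [mem_fixedSet, hm'.1.1] at hfix
        exact hne x hx hfix.symm
    · rw [Set.disjoint_left]
      rintro _ hx ⟨y, hy, rfl⟩
      have hadj := hm'.1.2 y (hne y hy)
      exact hJ hy.1 hx.1 hadj.ne hadj
  rw [Set.ncard_image_of_injective _ m'.injective] at c1
  have c2 := Set.ncard_inter_add_ncard_sdiff_eq_ncard (J : Set V) E
  rw [Set.ncard_coe_finset] at c2
  have c4 : ((J : Set V) ∩ E).ncard ≤ E.ncard := Set.ncard_le_ncard Set.inter_subset_right
  omega

/-- A vertex outside a critical independent set `K` is missed by some maximum independent set: away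
from `K` and its neighbourhood, deleting the bases leaves a bipartite graph with a perfect matching,
and either of its colour classes extends `K` to a maximum independent set. -/
theorem IsRDisjoint.exists_isMaximumIndepSet_notMem [Finite V] {G : SimpleGraph V}
    (hG : IsRDisjoint G) {K : Finset V} (hK : IsCriticalIndepSet G K) {x : V} (hx : x ∉ K) :
    ∃ S : Finset V, G.IsMaximumIndepSet S ∧ x ∉ S := by
  classical
  have := Fintype.ofFinite V
  obtain ⟨m, β, hm, h, hEK, hmK⟩ := hG.exists_matching_of_isCritical hK
  obtain ⟨κ, hκ⟩ := exists_coloring_off (G := G) (T := fixedSet m)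
    fun C hC => ⟨β C, (h C hC).1, (h C hC).2.1⟩
  let W : Set V := {w | w ∉ K ∧ w ∉ nbhd G K ∧ m w ≠ w}
  let R : Finset V := Finset.univ.filter fun w => w ∈ W ∧ κ w = !κ x
  have hR : ∀ w ∈ R, w ∈ W ∧ κ w = !κ x := fun w hw => (Finset.mem_filter.1 hw).2
  set E := fixedSet m \ oddVerts G with hE
  have hWm : ∀ w ∈ W, m w ∈ W := by
    rintro w ⟨hwK, hwN, hwm⟩
    refine ⟨fun hc => hwN ?_, fun hc => hwK ?_, fun hc => hwm ?_⟩
    · rw [← hmK]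
      refine ⟨m w, ⟨hc, fun hc' => hwm ?_⟩, hm.1.1 w⟩
      have := hc'.1
      rw [mem_fixedSet, hm.1.1] at this
      exact this.symm
    · rw [← hmK] at hc
      obtain ⟨k, hk, hkw⟩ := hc
      rw [← m.injective hkw]
      exact hk.1
    · rw [hm.1.1] at hc
      exact hc.symm
  have hdisj : Disjoint K R := by
    rw [Finset.disjoint_left]
    exact fun y hy hyR => (hR y hyR).1.1 hy
  have hind : G.IsIndepSet ((K ∪ R : Finset V) : Set V) := by
    have key : ∀ y ∈ K ∪ R, ∀ z ∈ K, ¬ G.Adj z y := by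
      intro y hy z hz hzy
      rcases Finset.mem_union.1 hy with hy | hy
      · exact hK.1 hz hy hzy.ne hzy
      · exact (hR y hy).1.2.1 ⟨z, hz, hzy⟩
    intro y hy z hz _ hyz
    rcases Finset.mem_union.1 hy with hy' | hy'
    · exact key z hz y hy' hyz
    rcases Finset.mem_union.1 hz with hz' | hz'
    · exact key y hy z hz' hyz.symm
    · exact hκ y z (hR y hy').1.2.2 (hR z hz').1.2.2 hyz
        ((hR y hy').2.trans (hR z hz').2.symm)
  have hcard : 2 * E.ncard + (fixedSet m)ᶜ.ncard ≤ 2 * (K ∪ R).card := by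
    rw [Finset.card_union_of_disjoint hdisj]
    have c1 : (fixedSet m)ᶜ.ncard ≤ ((K : Set V) \ E).ncard + (nbhd G K).ncard + W.ncard := by
      refine le_trans (Set.ncard_le_ncard (t := ((K : Set V) \ E) ∪ nbhd G K ∪ W) ?_) ?_
      · intro y hy
        by_cases h1 : y ∈ K
        · exact Or.inl (Or.inl ⟨h1, fun hc => hy hc.1⟩)
        by_cases h2 : y ∈ nbhd G K
        · exact Or.inl (Or.inr h2)
        · exact Or.inr ⟨h1, h2, hy⟩
      · have a1 := Set.ncard_union_le ((K : Set V) \ E ∪ nbhd G K) W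
        have a2 := Set.ncard_union_le ((K : Set V) \ E) (nbhd G K)
        omega
    have c2 : (nbhd G K).ncard = ((K : Set V) \ E).ncard := by
      rw [← hmK, Set.ncard_image_of_injective _ m.injective]
    have c3 : W.ncard ≤ 2 * R.card := by
      refine le_trans (Set.ncard_le_ncard (t := (R : Set V) ∪ m '' (R : Set V)) ?_) ?_
      · intro w hw
        by_cases hc : κ w = !κ x
        · exact Or.inl (Finset.mem_coe.2 (Finset.mem_filter.2 ⟨Finset.mem_univ _, hw, hc⟩))
        · have hmw := hWm w hw
          have hne := hκ w (m w) hw.2.2 hmw.2.2 (hm.1.2 w hw.2.2)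
          refine Or.inr ⟨m w, Finset.mem_coe.2 (Finset.mem_filter.2
            ⟨Finset.mem_univ _, hmw, ?_⟩), hm.1.1 w⟩
          revert hc hne
          cases κ w <;> cases κ (m w) <;> cases κ x <;> simp
      · have a1 := Set.ncard_union_le (R : Set V) (m '' (R : Set V))
        rw [Set.ncard_image_of_injective _ m.injective, Set.ncard_coe_finset] at a1
        omega
    have c4 := Set.ncard_inter_add_ncard_sdiff_eq_ncard (K : Set V) E
    have c5 : (K : Set V) ∩ E = E := Set.inter_eq_right.2 hEK
    rw [Set.ncard_coe_finset, c5] at c4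
    omega
  refine ⟨K ∪ R, ⟨hind, fun J hJ => ?_⟩, ?_⟩
  · have := hG.two_mul_card_le hm h hJ
    rw [← hE] at this
    omega
  · rw [Finset.mem_union, not_or]
    refine ⟨hx, fun hxR => ?_⟩
    have := (hR x hxR).2
    revert this
    cases κ x <;> simp

end RDisjoint

theorem mainTheorem1 {V : Type*} [Finite V] (G : SimpleGraph V) (hG : RDisjoint.IsRDisjoint G) :
    RDisjoint.ker G = RDisjoint.core G := by
  refine Set.Subset.antisymm (RDisjoint.ker_subset_core G) fun x hx => ?_
  rw [RDisjoint.mem_ker]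
  intro K hK
  by_contra hxK
  obtain ⟨S, hS, hxS⟩ := hG.exists_isMaximumIndepSet_notMem hK hxK
  exact hxS (RDisjoint.mem_core.1 hx S hS)
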